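/- Let $n\ge 2$. A bounded domain (non-empty, open, connected, bounded set) $D\subset\mathbb R^n$ with a function $s:D\to[1,\infty)$ is called an $s(\cdot)$-John domain with John constants $0<\alpha\le\beta<\infty$ and John center $x_0\in D$ if every $x\in D$ can be joined to $x_0$ by a rectifiable curve $\gamma_x:[0,\ell(\gamma_x)]\to D$, parametrized by arc length, with $\gamma_x(0)=x$, $\gamma_x(\ell(\gamma_x))=x_0$, $\ell(\gamma_x)\le\beta$ and \[ t^{s(x)}\le\frac{\beta}{\alpha}\,\operatorname{dist}(\gamma_x(t),\partial D)\qquad\text{for all } t\in[0,\ell(\gamma_x)]. \] Write $s^-$ and $s^+$ for the essential infimum and supremum of $s$ over $D$. For a measurable exponent $q:D\to[1,\infty)$ let \[ \|f\|_{L^{q(\cdot)}(D)}=\inf\Big\{\lambda>0:\int_D\Big|\frac{f(x)}{\lambda}\Big|^{q(x)}dx\le 1\Big\} \] be the Luxemburg norm, and let $L^1_1(D)$ be the set of all $u\in W^{1,1}_{\mathrm{loc}}(D)$ whose distributional gradient satisfies $|\nabla u|\in L^1(D)$. Theorem (Sobolev–Poincaré inequality, $p=1$). Let $D\subset\mathbb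 R^n$, $n\ge2$, be an $s(\cdot)$-John domain with John constants $\alpha,\beta$ and John center $x_0$. Assume that $s$ is log-Hölder continuous on $D$, that is, for some constant $L>0$, \[ |s(x)-s(y)|\le\frac{L}{\log(e+1/|x-y|)}\qquad\text{for all }x,y\in D,\ x\ne y, \] and that $1\le s^-\le s^+<\frac{n}{n-1}$. Put $B=B(x_0,\operatorname{dist}(x_0,\partial D))$ and $q(x)=\frac{n}{s(x)(n-1)}$. Then there is a constant $c$, depending only on $n$, $\alpha$, $\beta$, $s^+$, $\operatorname{dist}(x_0,\partial D)$ and $L$, such that every $u\in L^1_1(D)$ is integrable over $B$ and, with $u_B=\frac1{|B|}\int_B u\,dx$, \[ \|u-u_B\|_{L^{q(\cdot)}(D)}\le c\,\|\nabla u\|_{L^1(D)}. \] -/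

import Mathlib

open MeasureTheory Set
open scoped ENNReal NNReal ContDiff

noncomputable section

/-- `D` is a bounded `s(·)`-John domain with John constants `α ≤ β` and John center `x₀`: `D` is a
bounded domain, `s ≥ 1` on `D`, and every `x ∈ D` is joined to `x₀` inside `D` by a rectifiable
curve `γ : [0, ℓ] → D`, parametrized by arc length, of length `ℓ ≤ β`, such that
`t ^ s(x) ≤ (β / α) dist (γ t, ∂D)` for all `t ∈ [0, ℓ]`. Only the values of `s` on `D` matter. -/
structure IsJohnDomain {n : ℕ} (D : Set (EuclideanSpace ℝ (Fin n)))
    (s : EuclideanSpace ℝ (Fin n) → ℝ) (α β : ℝ) (x₀ : EuclideanSpace ℝ (Fin n)) : Prop where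
  isOpen : IsOpen D
  isConnected : IsConnected D
  isBounded : Bornology.IsBounded D
  one_le : ∀ x ∈ D, 1 ≤ s x
  alpha_pos : 0 < α
  alpha_le_beta : α ≤ β
  center_mem : x₀ ∈ D
  exists_curve : ∀ x ∈ D, ∃ (ℓ : ℝ) (γ : ℝ → EuclideanSpace ℝ (Fin n)),
    0 ≤ ℓ ∧ ℓ ≤ β ∧ HasUnitSpeedOn γ (Icc 0 ℓ) ∧ MapsTo γ (Icc 0 ℓ) D ∧
    γ 0 = x ∧ γ ℓ = x₀ ∧
    ∀ t ∈ Icc (0 : ℝ) ℓ, t ^ s x ≤ β / α * Metric.infDist (γ t) (frontier D)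

/-- The essential supremum `g⁺` of `g` over `U`, as an extended real number. -/
def essSupOn {n : ℕ} (g : EuclideanSpace ℝ (Fin n) → ℝ)
    (U : Set (EuclideanSpace ℝ (Fin n))) : EReal :=
  essSup (fun x => (g x : EReal)) (volume.restrict U)

/-- The essential infimum `g⁻` of `g` over `U`, as an extended real number. -/
def essInfOn {n : ℕ} (g : EuclideanSpace ℝ (Fin n) → ℝ)
    (U : Set (EuclideanSpace ℝ (Fin n))) : EReal :=
  essInf (fun x => (g x : EReal)) (volume.restrict U)

/-- `g` is log-Hölder continuous on `U` with constant `L > 0`. -/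
def LogHolderOnWith {n : ℕ} (L : ℝ) (g : EuclideanSpace ℝ (Fin n) → ℝ)
    (U : Set (EuclideanSpace ℝ (Fin n))) : Prop :=
  0 < L ∧ ∀ x ∈ U, ∀ y ∈ U, x ≠ y →
    |g x - g y| ≤ L / Real.log (Real.exp 1 + 1 / dist x y)

/-- The class of variable exponents on `U`: measurable, `[1, ∞)`-valued, with
`1 ≤ p⁻ ≤ p⁺ < ∞`. -/
structure IsVariableExponent {n : ℕ} (p : EuclideanSpace ℝ (Fin n) → ℝ)
    (U : Set (EuclideanSpace ℝ (Fin n))) : Prop where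
  aemeasurable : AEMeasurable p (volume.restrict U)
  one_le : ∀ x ∈ U, 1 ≤ p x
  essSup_lt_top : essSupOn p U < ⊤

/-- The modular `∫_U |f(x)|^{p(x)} dx` of the variable exponent Lebesgue space. -/
def modular {n : ℕ} (p f : EuclideanSpace ℝ (Fin n) → ℝ)
    (U : Set (EuclideanSpace ℝ (Fin n))) : ℝ≥0∞ :=
  ∫⁻ x in U, ENNReal.ofReal (|f x| ^ p x)

/-- The Luxemburg–Nakano norm `inf {t > 0 : modular (f / t) ≤ 1}` of `L^{p(·)}(U)`; it is `∞` if
there is no such `t`. -/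
def luxemburgNorm {n : ℕ} (p f : EuclideanSpace ℝ (Fin n) → ℝ)
    (U : Set (EuclideanSpace ℝ (Fin n))) : ℝ≥0∞ :=
  ⨅ t ∈ {t : ℝ | 0 < t ∧ modular p (fun x => f x / t) U ≤ 1}, ENNReal.ofReal t

/-- `u ∈ W^{1,1}_loc(U)` with distributional gradient `G`. -/
structure HasWeakGradientOn {n : ℕ} (u : EuclideanSpace ℝ (Fin n) → ℝ)
    (G : EuclideanSpace ℝ (Fin n) → EuclideanSpace ℝ (Fin n))
    (U : Set (EuclideanSpace ℝ (Fin n))) : Prop where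
  locallyIntegrableOn : LocallyIntegrableOn u U
  locallyIntegrableOn_gradient : LocallyIntegrableOn G U
  integral_eq : ∀ φ : EuclideanSpace ℝ (Fin n) → ℝ,
    ContDiff ℝ ∞ φ → HasCompactSupport φ → tsupport φ ⊆ U →
    ∀ v : EuclideanSpace ℝ (Fin n),
      ∫ x in U, u x * fderiv ℝ φ x v = -∫ x in U, inner ℝ (G x) v * φ x

/-- `u ∈ L^1_1(U)` with distributional gradient `G`: `u ∈ W^{1,1}_loc(U)` and
`|∇u| ∈ L^1(U)`. -/
def MemL11With {n : ℕ} (u : EuclideanSpace ℝ (Fin n) → ℝ)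
    (G : EuclideanSpace ℝ (Fin n) → EuclideanSpace ℝ (Fin n))
    (U : Set (EuclideanSpace ℝ (Fin n))) : Prop :=
  HasWeakGradientOn u G U ∧ IntegrableOn G U

end

/-! ### The Poincaré inequality on balls for smooth functions -/

section SmoothPoincare

variable {V : Type*} [NormedAddCommGroup V] [NormedSpace ℝ V] [FiniteDimensional ℝ V]
  [MeasurableSpace V] [BorelSpace V] {μ : Measure V} [μ.IsAddHaarMeasure]

theorem setLIntegral_comp_convexCombination_le {h : V → ℝ≥0∞} (hh : Measurable h) {z : V} {r : ℝ}
    {t : ℝ} (ht : 1 / 2 ≤ t) (ht1 : t ≤ 1) {x : V} (hx : x ∈ Metric.ball z r) :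
    ∫⁻ y in Metric.ball z r, h ((1 - t) • x + t • y) ∂μ
      ≤ 2 ^ Module.finrank ℝ V * ∫⁻ y in Metric.ball z r, h y ∂μ := by
  have ht0 : 0 < t := by linarith
  have hm : MeasurableSet (Metric.ball z r) := Metric.isOpen_ball.measurableSet
  set H : V → ℝ≥0∞ := (Metric.ball z r).indicator h with hH
  have hHm : Measurable H := hh.indicator hm
  have h1 : ∫⁻ y in Metric.ball z r, h ((1 - t) • x + t • y) ∂μ
      ≤ ∫⁻ y, H ((1 - t) • x + t • y) ∂μ := by
    rw [← lintegral_indicator hm]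
    refine lintegral_mono fun y => ?_
    by_cases hy : y ∈ Metric.ball z r
    · have : (1 - t) • x + t • y ∈ Metric.ball z r :=
        convex_ball z r hx hy (by linarith) ht0.le (by ring)
      simp [H, hy, this]
    · simp [hy]
  have h2 : ∫⁻ y, H ((1 - t) • x + t • y) ∂μ
      = ENNReal.ofReal |(t ^ Module.finrank ℝ V)⁻¹| * ∫⁻ y, H y ∂μ := by
    have h3 : ∫⁻ y, H ((1 - t) • x + y) ∂(Measure.map (t • ·) μ)
        = ∫⁻ y, H ((1 - t) • x + t • y) ∂μ := by
      rw [lintegral_map (by fun_prop) (by fun_prop)]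
    rw [← h3, Measure.map_addHaar_smul μ ht0.ne', lintegral_smul_measure,
      lintegral_add_left_eq_self (fun y => H y), smul_eq_mul]
  refine h1.trans ?_
  rw [h2, hH, lintegral_indicator hm]
  gcongr
  rw [abs_of_pos (by positivity), ← inv_pow]
  have : t⁻¹ ≤ 2 := by rw [inv_le_comm₀ ht0 two_pos]; linarith
  calc ENNReal.ofReal (t⁻¹ ^ Module.finrank ℝ V)
      ≤ ENNReal.ofReal (2 ^ Module.finrank ℝ V) := by gcongr
    _ = 2 ^ Module.finrank ℝ V := by
        rw [ENNReal.ofReal_pow (by norm_num)]; norm_num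

theorem lintegral_lintegral_comp_convexCombination_le {h : V → ℝ≥0∞} (hh : Measurable h) {z : V}
    {r : ℝ} {t : ℝ} (ht : 0 ≤ t) (ht1 : t ≤ 1) :
    ∫⁻ x in Metric.ball z r, ∫⁻ y in Metric.ball z r, h ((1 - t) • x + t • y) ∂μ ∂μ
      ≤ 2 ^ Module.finrank ℝ V * μ (Metric.ball z r) * ∫⁻ y in Metric.ball z r, h y ∂μ := by
  have hm : MeasurableSet (Metric.ball z r) := Metric.isOpen_ball.measurableSet
  have key : ∀ t : ℝ, 1 / 2 ≤ t → t ≤ 1 →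
      ∫⁻ x in Metric.ball z r, ∫⁻ y in Metric.ball z r, h ((1 - t) • x + t • y) ∂μ ∂μ
      ≤ 2 ^ Module.finrank ℝ V * μ (Metric.ball z r) * ∫⁻ y in Metric.ball z r, h y ∂μ := by
    intro t ht ht1
    calc _ ≤ ∫⁻ x in Metric.ball z r,
          2 ^ Module.finrank ℝ V * ∫⁻ y in Metric.ball z r, h y ∂μ ∂μ :=
          setLIntegral_mono' hm fun x hx => setLIntegral_comp_convexCombination_le hh ht ht1 hx
      _ = _ := by rw [setLIntegral_const]; ring
  rcases le_total (1 / 2) t with h2 | h2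
  · exact key t h2 ht1
  · rw [lintegral_lintegral_swap (by fun_prop)]
    have := key (1 - t) (by linarith) (by linarith)
    simpa only [sub_sub_cancel, add_comm] using this

theorem enorm_sub_le_lintegral_enorm_fderiv {f : V → ℝ} (hf : ContDiff ℝ 1 f) (x y : V) :
    ‖f x - f y‖ₑ ≤ ‖y - x‖ₑ *
      ∫⁻ t in Ioc (0 : ℝ) 1, ‖fderiv ℝ f ((1 - t) • x + t • y)‖ₑ := by
  have hd : ∀ t : ℝ, HasDerivAt (fun t : ℝ => f ((1 - t) • x + t • y))
      (fderiv ℝ f ((1 - t) • x + t • y) (y - x)) t := by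
    intro t
    have h1 : HasDerivAt (fun t : ℝ => (1 - t) • x + t • y) (y - x) t := by
      have := (((hasDerivAt_id t).const_sub 1).smul_const x).add ((hasDerivAt_id t).smul_const y)
      refine this.congr_deriv ?_
      rw [neg_one_smul, one_smul, neg_add_eq_sub]
    exact ((hf.differentiable one_ne_zero _).hasFDerivAt).comp_hasDerivAt t h1
  have hc : Continuous fun t : ℝ => fderiv ℝ f ((1 - t) • x + t • y) :=
    (hf.continuous_fderiv one_ne_zero).comp (by fun_prop)
  have hc' : Continuous fun t : ℝ => fderiv ℝ f ((1 - t) • x + t • y) (y - x) :=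
    hc.clm_apply continuous_const
  have h1 := intervalIntegral.integral_eq_sub_of_hasDerivAt (a := 0) (b := 1)
    (fun t _ => hd t) (hc'.intervalIntegrable 0 1)
  rw [intervalIntegral.integral_of_le zero_le_one] at h1
  have h2 : f x - f y
      = -∫ t in Ioc (0 : ℝ) 1, fderiv ℝ f ((1 - t) • x + t • y) (y - x) := by
    rw [h1]; simp
  rw [h2, enorm_neg]
  refine (enorm_integral_le_lintegral_enorm _).trans ?_
  rw [← lintegral_const_mul _ (by fun_prop)]
  refine lintegral_mono fun t => ?_
  rw [mul_comm]
  exact ContinuousLinearMap.le_opENorm _ _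

/-- The Poincaré inequality on a ball for `C¹` functions. -/
theorem ContDiff.lintegral_lintegral_enorm_sub_le {f : V → ℝ} (hf : ContDiff ℝ 1 f) (z : V)
    (r : ℝ) :
    ∫⁻ x in Metric.ball z r, ∫⁻ y in Metric.ball z r, ‖f x - f y‖ₑ ∂μ ∂μ
      ≤ 2 ^ (Module.finrank ℝ V + 1) * ENNReal.ofReal r * μ (Metric.ball z r)
        * ∫⁻ y in Metric.ball z r, ‖fderiv ℝ f y‖ₑ ∂μ := by
  have hm : MeasurableSet (Metric.ball z r) := Metric.isOpen_ball.measurableSet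
  have hc : Continuous (fderiv ℝ f) := hf.continuous_fderiv one_ne_zero
  set h : V → ℝ≥0∞ := fun y => ‖fderiv ℝ f y‖ₑ with hh
  have hhc : Continuous h := hc.enorm
  have hhm : Measurable h := hhc.measurable
  have hmeas : Measurable fun p : (V × V) × ℝ => h ((1 - p.2) • p.1.1 + p.2 • p.1.2) :=
    (hhc.comp (by fun_prop)).measurable
  calc ∫⁻ x in Metric.ball z r, ∫⁻ y in Metric.ball z r, ‖f x - f y‖ₑ ∂μ ∂μ
      ≤ ∫⁻ x in Metric.ball z r, ∫⁻ y in Metric.ball z r, ENNReal.ofReal (2 * r) *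
          (∫⁻ t in Ioc (0 : ℝ) 1, h ((1 - t) • x + t • y)) ∂μ ∂μ := by
        refine setLIntegral_mono' hm fun x hx => setLIntegral_mono' hm fun y hy => ?_
        refine (enorm_sub_le_lintegral_enorm_fderiv hf x y).trans ?_
        gcongr
        rw [← ofReal_norm]
        gcongr
        rw [← dist_eq_norm]
        have := dist_triangle_right y x z
        rw [Metric.mem_ball] at hx hy
        linarith
    _ = ENNReal.ofReal (2 * r) * ∫⁻ t in Ioc (0 : ℝ) 1, (∫⁻ x in Metric.ball z r,
          ∫⁻ y in Metric.ball z r, h ((1 - t) • x + t • y) ∂μ ∂μ) := by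
        have e1 : ∀ x, ∫⁻ y in Metric.ball z r, ENNReal.ofReal (2 * r) *
          (∫⁻ t in Ioc (0 : ℝ) 1, h ((1 - t) • x + t • y)) ∂μ
            = ENNReal.ofReal (2 * r) * ∫⁻ t in Ioc (0 : ℝ) 1, (∫⁻ y in Metric.ball z r,
              h ((1 - t) • x + t • y) ∂μ) := by
          intro x
          rw [lintegral_const_mul' _ _ ENNReal.ofReal_ne_top, lintegral_lintegral_swap]
          exact (hmeas.comp (by fun_prop :
            Measurable fun p : V × ℝ => ((x, p.1), p.2))).aemeasurable
        simp_rw [e1]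
        rw [lintegral_const_mul' _ _ ENNReal.ofReal_ne_top, lintegral_lintegral_swap]
        refine Measurable.aemeasurable ?_
        exact Measurable.lintegral_prod_right' (f := fun p : (V × ℝ) × V =>
          h ((1 - p.1.2) • p.1.1 + p.1.2 • p.2))
          (hhc.comp (by fun_prop)).measurable
    _ ≤ ENNReal.ofReal (2 * r) * ∫⁻ t in Ioc (0 : ℝ) 1, (2 ^ Module.finrank ℝ V *
          μ (Metric.ball z r) * ∫⁻ y in Metric.ball z r, h y ∂μ) := by
        refine mul_le_mul_right ?_ _
        exact setLIntegral_mono' measurableSet_Ioc fun t ht =>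
          lintegral_lintegral_comp_convexCombination_le hhm ht.1.le ht.2
    _ = _ := by
        rw [setLIntegral_const, Real.volume_Ioc, sub_zero, ENNReal.ofReal_one, mul_one,
          ENNReal.ofReal_mul two_pos.le, ENNReal.ofReal_ofNat, pow_succ]
        ring

end SmoothPoincare

/-! ### Mollification in `L¹` -/

section Mollification

open Filter Topology Convolution

/-- Scheffé's lemma: almost everywhere convergence together with a bound on the norms by the
norm of the limit implies convergence in `L¹`. -/
theorem tendsto_lintegral_enorm_sub_of_lintegral_enorm_le {Ω F : Type*} [MeasurableSpace Ω]
    [NormedAddCommGroup F] {μ : Measure Ω} {f : ℕ → Ω → F} {g : Ω → F}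
    (hf : ∀ k, AEStronglyMeasurable (f k) μ) (hg : Integrable g μ)
    (hlim : ∀ᵐ x ∂μ, Tendsto (fun k => f k x) atTop (𝓝 (g x)))
    (hle : ∀ k, ∫⁻ x, ‖f k x‖ₑ ∂μ ≤ ∫⁻ x, ‖g x‖ₑ ∂μ) :
    Tendsto (fun k => ∫⁻ x, ‖f k x - g x‖ₑ ∂μ) atTop (𝓝 0) := by
  set A := ∫⁻ x, ‖g x‖ₑ ∂μ with hA
  have hAt : A ≠ ⊤ := hg.2.ne
  have hgm := hg.1.enorm
  set e : ℕ → ℝ≥0∞ := fun k => ∫⁻ x, ‖f k x - g x‖ₑ ∂μ with he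
  have hem : ∀ k, AEMeasurable (fun x => ‖f k x - g x‖ₑ) μ := fun k => ((hf k).sub hg.1).enorm
  have hele : ∀ k, e k ≤ A + A := fun k => by
    calc e k ≤ ∫⁻ x, ‖f k x‖ₑ + ‖g x‖ₑ ∂μ := lintegral_mono fun x => enorm_sub_le
      _ = (∫⁻ x, ‖f k x‖ₑ ∂μ) + A := lintegral_add_left' (hf k).enorm _
      _ ≤ A + A := by gcongr; exact hle k
  have hek : ∀ k, e k ≠ ⊤ := fun k => ((hele k).trans_lt (by finiteness)).ne
  have h1 : A + A ≤ liminf (fun k => A + A - e k) atTop := by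
    calc A + A = ∫⁻ x, liminf (fun k => ‖f k x‖ₑ + ‖g x‖ₑ - ‖f k x - g x‖ₑ) atTop ∂μ := by
          rw [hA, ← lintegral_add_left' hgm]
          refine lintegral_congr_ae ?_
          filter_upwards [hlim] with x hx
          have t1 : Tendsto (fun k => ‖f k x‖ₑ + ‖g x‖ₑ - ‖f k x - g x‖ₑ) atTop
              (𝓝 (‖g x‖ₑ + ‖g x‖ₑ - ‖g x - g x‖ₑ)) := by
            refine ENNReal.Tendsto.sub (hx.enorm.add tendsto_const_nhds)
              (hx.sub_const _).enorm (Or.inl (by finiteness))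
          rw [t1.liminf_eq]
          simp
      _ ≤ liminf (fun k => ∫⁻ x, ‖f k x‖ₑ + ‖g x‖ₑ - ‖f k x - g x‖ₑ ∂μ) atTop :=
          lintegral_liminf_le' fun k => ((hf k).enorm.add hgm).sub (hem k)
      _ ≤ liminf (fun k => A + A - e k) atTop := by
          refine liminf_le_liminf (Eventually.of_forall fun k => ?_)
          change _ ≤ A + A - e k
          rw [lintegral_sub' (hem k) (hek k)
            (ae_of_all _ fun x => enorm_sub_le), lintegral_add_left' (hf k).enorm]
          gcongr
          exact hle k
  rw [ENNReal.tendsto_nhds_zero]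
  intro ε hε
  rcases eq_or_ne A 0 with h0 | h0
  · refine Eventually.of_forall fun k => ?_
    have := hele k
    rw [h0, add_zero, nonpos_iff_eq_zero] at this
    exact this ▸ hε.le
  · have hlt : A + A - ε < A + A := ENNReal.sub_lt_self (by finiteness) (by simp [h0]) hε.ne'
    filter_upwards [eventually_lt_of_lt_liminf (hlt.trans_le h1)] with k hk
    by_contra! hcon
    exact absurd hk (not_lt.2 (tsub_le_tsub_left hcon.le _))

variable {V : Type*} [NormedAddCommGroup V] [NormedSpace ℝ V] [FiniteDimensional ℝ V]
  [MeasurableSpace V] [BorelSpace V] {μ : Measure V} [μ.IsAddHaarMeasure]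
  [HasContDiffBump V]
  {F : Type*} [NormedAddCommGroup F] [NormedSpace ℝ F]

theorem ContDiffBump.lintegral_enorm_convolution_le (φ : ContDiffBump (0 : V)) {f : V → F}
    (hf : Integrable f μ) :
    ∫⁻ x, ‖(φ.normed μ ⋆[ContinuousLinearMap.lsmul ℝ ℝ, μ] f) x‖ₑ ∂μ ≤ ∫⁻ x, ‖f x‖ₑ ∂μ := by
  have h1 : ∫⁻ t, ‖φ.normed μ t‖ₑ ∂μ = 1 := by
    have : ∀ t, ‖φ.normed μ t‖ₑ = ENNReal.ofReal (φ.normed μ t) := fun t =>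
      Real.enorm_eq_ofReal (φ.nonneg_normed t)
    simp_rw [this]
    rw [← ofReal_integral_eq_lintegral_ofReal φ.integrable_normed
      (ae_of_all _ φ.nonneg_normed), φ.integral_normed, ENNReal.ofReal_one]
  calc ∫⁻ x, ‖(φ.normed μ ⋆[ContinuousLinearMap.lsmul ℝ ℝ, μ] f) x‖ₑ ∂μ
      ≤ ∫⁻ x, ∫⁻ t, ‖φ.normed μ t‖ₑ * ‖f (x - t)‖ₑ ∂μ ∂μ := by
        refine lintegral_mono fun x => ?_
        rw [convolution_def]
        refine (enorm_integral_le_lintegral_enorm _).trans (lintegral_mono fun t => ?_)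
        simp [enorm_smul]
    _ = ∫⁻ t, ∫⁻ x, ‖φ.normed μ t‖ₑ * ‖f (x - t)‖ₑ ∂μ ∂μ := by
        refine lintegral_lintegral_swap ?_
        have := (φ.integrable_normed (μ := μ)).aestronglyMeasurable.convolution_integrand
          (ContinuousLinearMap.lsmul ℝ ℝ) hf.aestronglyMeasurable (μ := μ)
        refine this.enorm.congr (ae_of_all _ fun p => ?_)
        simp [enorm_smul, Function.uncurry]
    _ = ∫⁻ t, ‖φ.normed μ t‖ₑ * ∫⁻ x, ‖f x‖ₑ ∂μ ∂μ := by
        refine lintegral_congr fun t => ?_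
        rw [lintegral_const_mul' _ _ enorm_ne_top,
          lintegral_sub_right_eq_self (fun x => ‖f x‖ₑ)]
    _ = ∫⁻ x, ‖f x‖ₑ ∂μ := by
        rw [lintegral_mul_const _ φ.continuous_normed.enorm.measurable, h1, one_mul]

theorem tendsto_lintegral_enorm_convolution_sub [CompleteSpace F]
    {φ : ℕ → ContDiffBump (0 : V)} {K : ℝ}
    (hφ : Tendsto (fun i => (φ i).rOut) atTop (𝓝 0))
    (h'φ : ∀ᶠ i in atTop, (φ i).rOut ≤ K * (φ i).rIn) {f : V → F} (hf : Integrable f μ) :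
    Tendsto (fun k => ∫⁻ x,
      ‖((φ k).normed μ ⋆[ContinuousLinearMap.lsmul ℝ ℝ, μ] f) x - f x‖ₑ ∂μ) atTop (𝓝 0) := by
  refine tendsto_lintegral_enorm_sub_of_lintegral_enorm_le (fun k => ?_) hf ?_ fun k =>
    (φ k).lintegral_enorm_convolution_le hf
  · exact ((φ k).hasCompactSupport_normed.continuous_convolution_left _
      (φ k).continuous_normed hf.locallyIntegrable).aestronglyMeasurable
  · exact ContDiffBump.ae_convolution_tendsto_right_of_locallyIntegrable hφ h'φ
      hf.locallyIntegrable

end Mollification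

/-! ### The Poincaré inequality on balls for compositions with weakly differentiable functions -/

section WeakPoincare

open Filter Topology Convolution

variable {n : ℕ}

theorem HasWeakGradientOn.fderiv_convolution {D K : Set (EuclideanSpace ℝ (Fin n))}
    {u : EuclideanSpace ℝ (Fin n) → ℝ} {G : EuclideanSpace ℝ (Fin n) → EuclideanSpace ℝ (Fin n)}
    (h : HasWeakGradientOn u G D) (hD : IsOpen D) (hK : IsCompact K) (hKD : K ⊆ D)
    (φ : ContDiffBump (0 : EuclideanSpace ℝ (Fin n))) {x : EuclideanSpace ℝ (Fin n)}
    (hx : Metric.closedBall x φ.rOut ⊆ K) :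
    fderiv ℝ (φ.normed volume ⋆[ContinuousLinearMap.lsmul ℝ ℝ, volume] K.indicator u) x
      = innerSL ℝ
        ((φ.normed volume ⋆[ContinuousLinearMap.lsmul ℝ ℝ, volume] K.indicator G) x) := by
  have hu : Integrable (K.indicator u) :=
    (h.locallyIntegrableOn.integrableOn_compact_subset hKD hK).integrable_indicator
      hK.measurableSet
  have hG : Integrable (K.indicator G) :=
    (h.locallyIntegrableOn_gradient.integrableOn_compact_subset hKD hK).integrable_indicator
      hK.measurableSet
  have hd := (φ.hasCompactSupport_normed (μ := volume)).hasFDerivAt_convolution_left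
    (ContinuousLinearMap.lsmul ℝ ℝ) (φ.contDiff_normed (n := 1)) hu.locallyIntegrable x
  rw [hd.fderiv]
  ext v
  set ψ : EuclideanSpace ℝ (Fin n) → ℝ := fun y => φ.normed volume (x - y) with hψ
  have hψc : ContDiff ℝ ∞ ψ := φ.contDiff_normed.comp (contDiff_const.sub contDiff_id)
  have hts : tsupport ψ ⊆ Metric.closedBall x φ.rOut := by
    refine closure_minimal (fun y hy => ?_) Metric.isClosed_closedBall
    have : x - y ∈ Function.support (φ.normed volume) := hy
    rw [φ.support_normed_eq] at this
    rw [Metric.mem_closedBall, dist_comm, dist_eq_norm]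
    exact (mem_ball_zero_iff.1 this).le
  have hψ0 : ∀ y, y ∉ K → ψ y = 0 := fun y hy =>
    image_eq_zero_of_notMem_tsupport fun h' => hy (hx (hts h'))
  have hψs : HasCompactSupport ψ :=
    (isCompact_closedBall x φ.rOut).of_isClosed_subset (isClosed_tsupport _) hts
  have hfd : ∀ y, fderiv ℝ ψ y v = - fderiv ℝ (φ.normed volume) (x - y) v := by
    intro y
    have h1 : HasFDerivAt (φ.normed volume) (fderiv ℝ (φ.normed volume) (x - y)) (x - y) :=
      ((φ.contDiff_normed (n := 1)).differentiable one_ne_zero _).hasFDerivAt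
    have h2 : HasFDerivAt ψ _ y := h1.comp y ((hasFDerivAt_const x y).sub (hasFDerivAt_id y))
    rw [h2.fderiv]
    simp
  have hfd0 : ∀ y, y ∉ K → fderiv ℝ ψ y v = 0 := fun y hy => by
    have : fderiv ℝ ψ y = 0 := image_eq_zero_of_notMem_tsupport fun h' =>
      hy (hx (hts (tsupport_fderiv_subset ℝ h')))
    simp [this]
  have hInt := h.integral_eq ψ hψc hψs (hts.trans (hx.trans hKD)) v
  have e1 : ∫ y in D, u y * fderiv ℝ ψ y v
      = -∫ y, fderiv ℝ (φ.normed volume) (x - y) v * K.indicator u y := by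
    rw [← integral_indicator hD.measurableSet, ← integral_neg]
    refine integral_congr_ae (ae_of_all _ fun y => ?_)
    by_cases hy : y ∈ K
    · simp [hy, hKD hy, hfd, mul_comm]
    · by_cases hyD : y ∈ D <;> simp [hy, hyD, hfd0]
  have e2 : ∫ y in D, inner ℝ (G y) v * ψ y = ∫ y, inner ℝ (ψ y • K.indicator G y) v := by
    rw [← integral_indicator hD.measurableSet]
    refine integral_congr_ae (ae_of_all _ fun y => ?_)
    by_cases hy : y ∈ K
    · simp [hy, hKD hy, inner_smul_left, mul_comm]
    · by_cases hyD : y ∈ D <;> simp [hy, hyD, hψ0]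
  have hGi : Integrable fun y => ψ y • K.indicator G y :=
    ((φ.hasCompactSupport_normed (μ := volume)).convolutionExists_left
      (ContinuousLinearMap.lsmul ℝ ℝ) φ.continuous_normed hG.locallyIntegrable x).integrable_swap
  have hui : Integrable fun y => (ContinuousLinearMap.lsmul ℝ ℝ).precompL
      (EuclideanSpace ℝ (Fin n)) (fderiv ℝ (φ.normed volume) (x - y)) (K.indicator u y) :=
    (((φ.hasCompactSupport_normed (μ := volume)).fderiv ℝ).convolutionExists_left
      _ ((φ.contDiff_normed (n := 1)).continuous_fderiv one_ne_zero)
      hu.locallyIntegrable x).integrable_swap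
  rw [convolution_eq_swap, ContinuousLinearMap.integral_apply hui, innerSL_apply_apply,
    convolution_eq_swap]
  rw [e1, e2, neg_inj] at hInt
  simp only [ContinuousLinearMap.precompL_apply, ContinuousLinearMap.lsmul_apply, smul_eq_mul]
  rw [hInt, real_inner_comm, ← integral_inner hGi]
  simp_rw [real_inner_comm v]

/-- The Poincaré inequality on a ball for the composition of a `C¹` function with bounded
derivative and a weakly differentiable function. -/
theorem HasWeakGradientOn.lintegral_lintegral_enorm_comp_sub_le
    {D : Set (EuclideanSpace ℝ (Fin n))}
    {u : EuclideanSpace ℝ (Fin n) → ℝ} {G : EuclideanSpace ℝ (Fin n) → EuclideanSpace ℝ (Fin n)}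
    (h : HasWeakGradientOn u G D) (hD : IsOpen D) {z : EuclideanSpace ℝ (Fin n)} {r : ℝ}
    (hr : Metric.closedBall z r ⊆ D) {Φ : ℝ → ℝ} (hΦ : ContDiff ℝ 1 Φ) {M : ℝ≥0}
    (hM : ∀ t, ‖deriv Φ t‖ₑ ≤ M) :
    ∫⁻ x in Metric.ball z r, ∫⁻ y in Metric.ball z r, ‖Φ (u x) - Φ (u y)‖ₑ
      ≤ 2 ^ (n + 1) * ENNReal.ofReal r * volume (Metric.ball z r)
        * ∫⁻ y in Metric.ball z r, ‖deriv Φ (u y)‖ₑ * ‖G y‖ₑ := by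
  obtain ⟨η, hη, hηD⟩ := (isCompact_closedBall z r).exists_cthickening_subset_open hD hr
  set K := Metric.cthickening η (Metric.closedBall z r) with hKdef
  have hK : IsCompact K := (isCompact_closedBall z r).cthickening
  have hbK : Metric.ball z r ⊆ K :=
    Metric.ball_subset_closedBall.trans (Metric.self_subset_cthickening _)
  have hbm : MeasurableSet (Metric.ball z r) := Metric.isOpen_ball.measurableSet
  have hu : Integrable (K.indicator u) :=
    (h.locallyIntegrableOn.integrableOn_compact_subset hηD hK).integrable_indicator
      hK.measurableSet
  have hG : Integrable (K.indicator G) :=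
    (h.locallyIntegrableOn_gradient.integrableOn_compact_subset hηD hK).integrable_indicator
      hK.measurableSet
  set φ : ℕ → ContDiffBump (0 : EuclideanSpace ℝ (Fin n)) := fun k =>
    ⟨η / (k + 1) / 2, η / (k + 1), by positivity, half_lt_self (by positivity)⟩ with hφ
  have hφ0 : Tendsto (fun k => (φ k).rOut) atTop (𝓝 0) := by
    simpa [hφ, div_eq_mul_inv] using
      (tendsto_one_div_add_atTop_nhds_zero_nat (𝕜 := ℝ)).const_mul η
  have hφ2 : ∀ᶠ k in atTop, (φ k).rOut ≤ 2 * (φ k).rIn := by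
    refine Eventually.of_forall fun k => ?_
    simp only [hφ]
    linarith
  have hφη : ∀ k, (φ k).rOut ≤ η := fun k => by
    simp only [hφ]
    exact div_le_self hη.le (by linarith [(k.cast_nonneg : (0 : ℝ) ≤ k)])
  set f : ℕ → EuclideanSpace ℝ (Fin n) → ℝ := fun k =>
    (φ k).normed volume ⋆[ContinuousLinearMap.lsmul ℝ ℝ, volume] K.indicator u with hf
  set H : ℕ → EuclideanSpace ℝ (Fin n) → EuclideanSpace ℝ (Fin n) := fun k =>
    (φ k).normed volume ⋆[ContinuousLinearMap.lsmul ℝ ℝ, volume] K.indicator G with hH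
  have hfs : ∀ k, ContDiff ℝ 1 (f k) := fun k =>
    (φ k).hasCompactSupport_normed.contDiff_convolution_left _ (φ k).contDiff_normed
      hu.locallyIntegrable
  have hfH : ∀ k, ∀ x ∈ Metric.ball z r, fderiv ℝ (f k) x = innerSL ℝ (H k x) := fun k x hx =>
    h.fderiv_convolution hD hK hηD (φ k)
      ((Metric.closedBall_subset_closedBall (hφη k)).trans
        (Metric.closedBall_subset_cthickening (Metric.ball_subset_closedBall hx) η))
  have hlim : ∀ᵐ x ∂volume.restrict (Metric.ball z r),
      Tendsto (fun k => f k x) atTop (𝓝 (u x)) := by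
    filter_upwards [ae_restrict_of_ae
      (ContDiffBump.ae_convolution_tendsto_right_of_locallyIntegrable hφ0 hφ2
        hu.locallyIntegrable), ae_restrict_mem hbm] with x hx hxb
    simpa [hbK hxb] using hx
  have hHlim : Tendsto (fun k => ∫⁻ x in Metric.ball z r, ‖H k x - G x‖ₑ) atTop (𝓝 0) := by
    refine tendsto_of_tendsto_of_tendsto_of_le_of_le tendsto_const_nhds
      (tendsto_lintegral_enorm_convolution_sub hφ0 hφ2 hG) (fun _ => zero_le) fun k => ?_
    calc ∫⁻ x in Metric.ball z r, ‖H k x - G x‖ₑ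
        = ∫⁻ x in Metric.ball z r, ‖H k x - K.indicator G x‖ₑ :=
          setLIntegral_congr_fun hbm fun x hx => by simp [hbK hx]
      _ ≤ _ := setLIntegral_le_lintegral _ _
  have hΦ' : Continuous (deriv Φ) := hΦ.continuous_deriv le_rfl
  have hum : AEMeasurable u (volume.restrict (Metric.ball z r)) := by
    refine hu.aestronglyMeasurable.aemeasurable.restrict.congr ?_
    filter_upwards [ae_restrict_mem hbm] with x hx
    simp [hbK hx]
  have hGi : IntegrableOn G (Metric.ball z r) := by
    refine hG.integrableOn.congr ?_
    filter_upwards [ae_restrict_mem hbm] with x hx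
    simp [hbK hx]
  set C : ℝ≥0∞ := 2 ^ (n + 1) * ENNReal.ofReal r * volume (Metric.ball z r) with hC
  have hCt : C ≠ ⊤ := by
    have := (measure_ball_lt_top (μ := volume) (x := z) (r := r)).ne
    finiteness
  have hstep : ∀ k, ∫⁻ x in Metric.ball z r, ∫⁻ y in Metric.ball z r, ‖Φ (f k x) - Φ (f k y)‖ₑ
      ≤ C * ((∫⁻ x in Metric.ball z r, ‖deriv Φ (f k x)‖ₑ * ‖G x‖ₑ)
        + M * ∫⁻ x in Metric.ball z r, ‖H k x - G x‖ₑ) := by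
    intro k
    refine ((hΦ.comp (hfs k)).lintegral_lintegral_enorm_sub_le z r).trans ?_
    rw [finrank_euclideanSpace_fin, ← hC]
    refine mul_le_mul_right ?_ _
    rw [← lintegral_const_mul' _ _ ENNReal.coe_ne_top, ← lintegral_add_left' ?_]
    · refine setLIntegral_mono' hbm fun x hx => ?_
      have hd : fderiv ℝ (Φ ∘ f k) x = deriv Φ (f k x) • fderiv ℝ (f k) x := by
        have h1 := (hΦ.differentiable one_ne_zero (f k x)).hasDerivAt
        have h2 := ((hfs k).differentiable one_ne_zero x).hasFDerivAt
        exact (h1.comp_hasFDerivAt x h2).fderiv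
      rw [hd, enorm_smul, hfH k x hx]
      have e : ‖innerSL ℝ (H k x)‖ₑ = ‖H k x‖ₑ := by
        rw [← ofReal_norm, ← ofReal_norm, innerSL_apply_norm]
      rw [e]
      calc ‖deriv Φ (f k x)‖ₑ * ‖H k x‖ₑ
          ≤ ‖deriv Φ (f k x)‖ₑ * (‖G x‖ₑ + ‖H k x - G x‖ₑ) := by
            gcongr
            simpa using enorm_add_le (G x) (H k x - G x)
        _ ≤ _ := by rw [mul_add]; gcongr; exact hM _
    · exact (hΦ'.comp (hfs k).continuous).enorm.aemeasurable.mul hGi.aestronglyMeasurable.enorm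
  have hrhs : Tendsto (fun k => C * ((∫⁻ x in Metric.ball z r, ‖deriv Φ (f k x)‖ₑ * ‖G x‖ₑ)
        + M * ∫⁻ x in Metric.ball z r, ‖H k x - G x‖ₑ)) atTop
      (𝓝 (C * ((∫⁻ x in Metric.ball z r, ‖deriv Φ (u x)‖ₑ * ‖G x‖ₑ) + M * 0))) := by
    refine ENNReal.Tendsto.const_mul (Tendsto.add ?_
      (ENNReal.Tendsto.const_mul hHlim (Or.inr ENNReal.coe_ne_top))) (Or.inr hCt)
    refine tendsto_lintegral_of_dominated_convergence' (fun x => M * ‖G x‖ₑ) (fun k => ?_)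
      (fun k => ae_of_all _ fun x => mul_le_mul_left (hM _) _) ?_ ?_
    · exact (hΦ'.comp (hfs k).continuous).enorm.aemeasurable.mul hGi.aestronglyMeasurable.enorm
    · rw [lintegral_const_mul' _ _ ENNReal.coe_ne_top]
      exact ENNReal.mul_ne_top ENNReal.coe_ne_top hGi.2.ne
    · filter_upwards [hlim] with x hx
      exact ENNReal.Tendsto.mul_const ((hΦ'.tendsto _).comp hx).enorm (Or.inr enorm_ne_top)
  rw [mul_zero, add_zero] at hrhs
  have hΦc := hΦ.continuous
  have hcont : ∀ k, Continuous fun p : EuclideanSpace ℝ (Fin n) × EuclideanSpace ℝ (Fin n) =>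
      ‖Φ (f k p.1) - Φ (f k p.2)‖ₑ := fun k => by
    have := (hfs k).continuous
    fun_prop
  calc ∫⁻ x in Metric.ball z r, ∫⁻ y in Metric.ball z r, ‖Φ (u x) - Φ (u y)‖ₑ
      ≤ ∫⁻ x in Metric.ball z r, liminf (fun k =>
          ∫⁻ y in Metric.ball z r, ‖Φ (f k x) - Φ (f k y)‖ₑ) atTop := by
        refine lintegral_mono_ae ?_
        filter_upwards [hlim] with x hx
        calc ∫⁻ y in Metric.ball z r, ‖Φ (u x) - Φ (u y)‖ₑ
            = ∫⁻ y in Metric.ball z r, liminf (fun k => ‖Φ (f k x) - Φ (f k y)‖ₑ) atTop := by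
              refine lintegral_congr_ae ?_
              filter_upwards [hlim] with y hy
              exact ((((hΦc.tendsto _).comp hx).sub ((hΦc.tendsto _).comp hy)).enorm).liminf_eq.symm
          _ ≤ _ := lintegral_liminf_le fun k =>
              ((hcont k).comp (by fun_prop : Continuous fun y => (x, y))).measurable
    _ ≤ liminf (fun k => ∫⁻ x in Metric.ball z r,
          ∫⁻ y in Metric.ball z r, ‖Φ (f k x) - Φ (f k y)‖ₑ) atTop :=
        lintegral_liminf_le fun k => (hcont k).measurable.lintegral_prod_right'
    _ ≤ liminf (fun k => C * ((∫⁻ x in Metric.ball z r, ‖deriv Φ (f k x)‖ₑ * ‖G x‖ₑ)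
        + M * ∫⁻ x in Metric.ball z r, ‖H k x - G x‖ₑ)) atTop :=
        liminf_le_liminf (Eventually.of_forall hstep)
    _ = _ := hrhs.liminf_eq

end WeakPoincare

/-! ### Chains of balls along a curve -/

section Chains

theorem IsOpen.ball_infDist_frontier_subset {V : Type*} [NormedAddCommGroup V] [NormedSpace ℝ V]
    {D : Set V} (hD : IsOpen D) {x : V} (hx : x ∈ D) :
    Metric.ball x (Metric.infDist x (frontier D)) ⊆ D := by
  rcases le_or_gt (Metric.infDist x (frontier D)) 0 with h0 | h0
  · rw [Metric.ball_eq_empty.2 h0]; exact empty_subset _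
  have hcov : Metric.ball x (Metric.infDist x (frontier D)) ⊆ D ∪ (closure D)ᶜ := by
    intro y hy
    by_contra! hcon
    rw [mem_union, not_or, notMem_compl_iff] at hcon
    have hyf : y ∈ frontier D := by rw [hD.frontier_eq]; exact ⟨hcon.2, hcon.1⟩
    exact absurd (Metric.mem_ball'.1 hy) (not_lt.2 (Metric.infDist_le_dist_of_mem hyf))
  exact (convex_ball x _).isPreconnected.subset_left_of_subset_union hD
    isClosed_closure.isOpen_compl (disjoint_compl_right.mono_left subset_closure) hcov
    ⟨x, Metric.mem_ball_self h0, hx⟩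

/-- Last-exit chain of points on a `1`-Lipschitz curve: consecutive points are close, and points
that are not the last one stay away from all earlier ones. -/
theorem exists_lastExit_chain {X : Type*} [PseudoMetricSpace X] {γ : ℝ → X} {ℓ : ℝ} (hℓ : 0 ≤ ℓ)
    (hγ : ∀ a ∈ Icc 0 ℓ, ∀ b ∈ Icc 0 ℓ, dist (γ a) (γ b) ≤ |a - b|) {ρ : ℝ → ℝ} {ε : ℝ}
    (hε : 0 < ε) (hρ : ∀ t ∈ Icc 0 ℓ, ε ≤ ρ t) :
    ∃ (N : ℕ) (t : ℕ → ℝ), (∀ i, t i ∈ Icc 0 ℓ) ∧ t 0 = 0 ∧ t N = ℓ ∧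
      (∀ i, dist (γ (t (i + 1))) (γ (t i)) ≤ ρ (t i)) ∧
      ∀ i j, i < j → j < N → ρ (t i) ≤ dist (γ (t j)) (γ (t i)) := by
  have hcont : ContinuousOn γ (Icc 0 ℓ) := by
    refine LipschitzOnWith.continuousOn (K := 1)
      (LipschitzOnWith.of_dist_le_mul fun a ha b hb => ?_)
    rw [NNReal.coe_one, one_mul, Real.dist_eq]
    exact hγ a ha b hb
  set S : ℝ → Set ℝ := fun a => {b ∈ Icc 0 ℓ | dist (γ b) (γ a) ≤ ρ a} with hS
  have hself : ∀ a ∈ Icc 0 ℓ, a ∈ S a := fun a ha =>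
    ⟨ha, by rw [dist_self]; exact hε.le.trans (hρ a ha)⟩
  have hScomp : ∀ a, IsCompact (S a) := fun a => by
    have : IsClosed (S a) := by
      have h1 : ContinuousOn (fun b => dist (γ b) (γ a)) (Icc 0 ℓ) :=
        continuous_dist.comp_continuousOn (hcont.prodMk continuousOn_const)
      exact h1.preimage_isClosed_of_isClosed isClosed_Icc isClosed_Iic
    exact isCompact_Icc.of_isClosed_subset this fun b hb => hb.1
  have hbdd : ∀ a, BddAbove (S a) := fun a => ⟨ℓ, fun b hb => hb.1.2⟩
  set next : ℝ → ℝ := fun a => sSup (S a) with hnext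
  have hmem : ∀ a ∈ Icc 0 ℓ, next a ∈ S a := fun a ha => (hScomp a).sSup_mem ⟨a, hself a ha⟩
  set t : ℕ → ℝ := fun i => next^[i] 0 with ht
  have htS : ∀ i, t (i + 1) = next (t i) := fun i => by
    simp only [ht, Function.iterate_succ_apply']
  have htI : ∀ i, t i ∈ Icc 0 ℓ := by
    intro i
    induction i with
    | zero => exact ⟨le_rfl, hℓ⟩
    | succ i ih => rw [htS]; exact (hmem _ ih).1
  have hmono : Monotone t := monotone_nat_of_le_succ fun i => by
    rw [htS]; exact le_csSup (hbdd _) (hself _ (htI i))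
  have hgrow : ∀ i : ℕ, min ℓ (i * ε) ≤ t i := by
    intro i
    induction i with
    | zero => simp [ht, hℓ]
    | succ i ih =>
      by_cases hc : t i + ε ≤ ℓ
      · have hin : t i + ε ∈ S (t i) := by
          have hI : t i + ε ∈ Icc 0 ℓ := ⟨by linarith [(htI i).1], hc⟩
          refine ⟨hI, (hγ _ hI _ (htI i)).trans ?_⟩
          rw [add_sub_cancel_left, abs_of_pos hε]
          exact hρ _ (htI i)
        have h1 : t i + ε ≤ t (i + 1) := by rw [htS]; exact le_csSup (hbdd _) hin
        rcases min_le_iff.1 ih with h2 | h2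
        · exact (min_le_left _ _).trans (by linarith)
        · refine (min_le_right _ _).trans ?_
          push_cast
          linarith
      · have hin : ℓ ∈ S (t i) := by
          have hI : ℓ ∈ Icc 0 ℓ := ⟨hℓ, le_rfl⟩
          refine ⟨hI, (hγ _ hI _ (htI i)).trans ?_⟩
          rw [abs_of_nonneg (by linarith [(htI i).2])]
          linarith [hρ _ (htI i)]
        have h1 : ℓ ≤ t (i + 1) := by rw [htS]; exact le_csSup (hbdd _) hin
        exact (min_le_left _ _).trans h1
  have hex : ∃ N, t N = ℓ := by
    obtain ⟨N, hN⟩ := exists_nat_ge (ℓ / ε)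
    refine ⟨N, le_antisymm (htI N).2 ?_⟩
    rw [div_le_iff₀ hε] at hN
    simpa [min_eq_left hN] using hgrow N
  classical
  refine ⟨Nat.find hex, t, htI, rfl, Nat.find_spec hex, fun i => ?_, fun i j hij hj => ?_⟩
  · rw [htS]; exact (hmem _ (htI i)).2
  · by_contra! hlt
    have htj : t j < ℓ := lt_of_le_of_ne (htI j).2 (Nat.find_min hex hj)
    obtain ⟨η, hη0, hη⟩ : ∃ η, 0 < η ∧ η ≤ ℓ - t j ∧ η ≤ ρ (t i) - dist (γ (t j)) (γ (t i)) :=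
      ⟨min (ℓ - t j) (ρ (t i) - dist (γ (t j)) (γ (t i))),
        lt_min (by linarith) (by linarith), min_le_left _ _, min_le_right _ _⟩
    have hI : t j + η ∈ Icc 0 ℓ := ⟨by linarith [(htI j).1], by linarith [hη.1]⟩
    have hin : t j + η ∈ S (t i) := by
      refine ⟨hI, (dist_triangle _ (γ (t j)) _).trans ?_⟩
      have := hγ _ hI _ (htI j)
      rw [add_sub_cancel_left, abs_of_pos hη0] at this
      linarith [hη.2]
    have h1 : t j + η ≤ t (i + 1) := by rw [htS]; exact le_csSup (hbdd _) hin
    linarith [hmono (show i + 1 ≤ j from hij)]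

theorem card_mul_pow_le_of_separated {V ι : Type*} [NormedAddCommGroup V] [NormedSpace ℝ V]
    [FiniteDimensional ℝ V] (I : Finset ι) (p : ι → V) (y : V) {ε R : ℝ} (hε : 0 < ε) (hR : 0 ≤ R)
    (hsep : ∀ i ∈ I, ∀ j ∈ I, i ≠ j → 2 * ε ≤ dist (p i) (p j))
    (hp : ∀ i ∈ I, dist (p i) y ≤ R) :
    (I.card : ℝ) * ε ^ Module.finrank ℝ V ≤ (R + ε) ^ Module.finrank ℝ V := by
  borelize V
  let μ : Measure V := Measure.addHaar
  have hdisj : (I : Set ι).PairwiseDisjoint fun i => Metric.ball (p i) ε := by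
    intro i hi j hj hij
    exact Metric.ball_disjoint_ball (by linarith [hsep i hi j hj hij])
  have hsub : ⋃ i ∈ I, Metric.ball (p i) ε ⊆ Metric.ball y (R + ε) := by
    refine iUnion₂_subset fun i hi => Metric.ball_subset_ball' ?_
    linarith [hp i hi]
  have h1 : ∑ i ∈ I, μ (Metric.ball (p i) ε) ≤ μ (Metric.ball y (R + ε)) := by
    rw [← measure_biUnion_finset hdisj fun i _ => Metric.isOpen_ball.measurableSet]
    exact measure_mono hsub
  simp_rw [Measure.addHaar_ball_of_pos μ _ hε,
    Measure.addHaar_ball_of_pos μ y (by linarith : 0 < R + ε)] at h1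
  rw [Finset.sum_const, nsmul_eq_mul, ← mul_assoc,
    ENNReal.mul_le_mul_iff_left (Metric.measure_ball_pos μ _ one_pos).ne' measure_ball_lt_top.ne,
    ← ENNReal.ofReal_natCast, ← ENNReal.ofReal_mul (by positivity),
    ENNReal.ofReal_le_ofReal_iff (by positivity)] at h1
  exact h1

/-- Bounded overlap of balls whose radii are proportional to a `1`-Lipschitz function and whose
centers are separated accordingly. -/
theorem card_filter_mem_ball_le {V : Type*} [NormedAddCommGroup V] [NormedSpace ℝ V]
    [FiniteDimensional ℝ V] {d : V → ℝ} (hd : ∀ a b, d a ≤ d b + dist a b) {N : ℕ} {p : ℕ → V}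
    (hpos : ∀ i, 0 < d (p i))
    (hsep : ∀ i j, i < j → j < N → d (p i) / 4 ≤ dist (p j) (p i)) (y : V)
    (I : Finset ℕ) (hI : ∀ i ∈ I, i < N ∧ dist y (p i) < 3 / 4 * d (p i)) :
    I.card ≤ 43 ^ Module.finrank ℝ V := by
  rcases I.eq_empty_or_nonempty with rfl | ⟨i₀, hi₀⟩
  · simp
  have hlow : ∀ i ∈ I, 4 / 7 * d y ≤ d (p i) := fun i hi => by
    have := hd y (p i)
    have := (hI i hi).2
    linarith
  have hup : ∀ i ∈ I, d (p i) ≤ 4 * d y := fun i hi => by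
    have h1 := hd (p i) y
    rw [dist_comm] at h1
    have := (hI i hi).2
    linarith
  have hdy : 0 < d y := by linarith [hup i₀ hi₀, hpos i₀]
  have key := card_mul_pow_le_of_separated I p y (ε := d y / 14) (R := 3 * d y) (by positivity)
    (by positivity) (fun i hi j hj hij => ?_) (fun i hi => ?_)
  · have e : 3 * d y + d y / 14 = 43 * (d y / 14) := by ring
    rw [e, mul_pow] at key
    have := le_of_mul_le_mul_right key (by positivity)
    exact_mod_cast this
  · rcases lt_or_gt_of_ne hij with h | h
    · have := hsep i j h (hI j hj).1
      rw [dist_comm] at this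
      linarith [hlow i hi]
    · have := hsep j i h (hI i hi).1
      linarith [hlow j hj]
  · rw [dist_comm]
    linarith [(hI i hi).2, hup i hi]

theorem sum_indicator_dyadic_le {r ρ : ℝ} (hr : 0 < r) (hρ : 0 < ρ) {m : ℕ} (hm : 1 ≤ m) (K : ℕ) :
    ∑ k ∈ Finset.range K, (if r < ρ / 2 ^ k then ((ρ / 2 ^ k) ^ m)⁻¹ else 0) ≤ 2 * (r ^ m)⁻¹ := by
  suffices h : ∑ k ∈ Finset.range K, (if r < ρ / 2 ^ k then ((ρ / 2 ^ k) ^ m)⁻¹ else 0)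
      ≤ 2 * (r ^ m)⁻¹ ∧
      ∑ k ∈ Finset.range K, (if r < ρ / 2 ^ k then ((ρ / 2 ^ k) ^ m)⁻¹ else 0)
        ≤ ((ρ / 2 ^ K) ^ m)⁻¹ from h.1
  induction K with
  | zero => constructor <;> simp <;> positivity
  | succ K ih =>
    rw [Finset.sum_range_succ]
    have hdbl : 2 * ((ρ / 2 ^ K) ^ m)⁻¹ ≤ ((ρ / 2 ^ (K + 1)) ^ m)⁻¹ := by
      have e : ((ρ / 2 ^ (K + 1)) ^ m)⁻¹ = 2 ^ m * ((ρ / 2 ^ K) ^ m)⁻¹ := by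
        rw [pow_succ, ← div_div, div_pow _ (2 : ℝ), inv_div, div_eq_mul_inv]
      rw [e]
      gcongr
      calc (2 : ℝ) = 2 ^ 1 := (pow_one _).symm
        _ ≤ 2 ^ m := pow_le_pow_right₀ one_le_two hm
    have hpos : 0 ≤ ((ρ / 2 ^ K) ^ m)⁻¹ := by positivity
    split_ifs with h
    · have : ((ρ / 2 ^ K) ^ m)⁻¹ ≤ (r ^ m)⁻¹ := by gcongr
      constructor <;> linarith [ih.2]
    · constructor <;> linarith [ih.1, ih.2]

end Chains

/-! ### Comparison of averages -/

section Averages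

theorem enorm_setAverage_sub_le {Ω : Type*} [MeasurableSpace Ω] {μ : Measure Ω} {A : Set Ω}
    {v : Ω → ℝ} (h0 : μ A ≠ 0) (ht : μ A ≠ ⊤) (hv : IntegrableOn v A μ) (c : ℝ) :
    ‖(⨍ x in A, v x ∂μ) - c‖ₑ ≤ (μ A)⁻¹ * ∫⁻ x in A, ‖v x - c‖ₑ ∂μ := by
  have e : (⨍ x in A, v x ∂μ) - c = (μ.real A)⁻¹ • ∫ x in A, (v x - c) ∂μ := by
    have : μ.real A ≠ 0 := (ENNReal.toReal_pos h0 ht).ne'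
    rw [integral_sub hv (integrableOn_const ht), setAverage_eq, setIntegral_const, smul_eq_mul,
      smul_eq_mul, smul_eq_mul]
    field_simp
  have e2 : ‖(μ.real A)⁻¹‖ₑ = (μ A)⁻¹ := by
    rw [Real.enorm_eq_ofReal (by positivity), measureReal_def, ENNReal.ofReal_inv_of_pos
      (ENNReal.toReal_pos h0 ht), ENNReal.ofReal_toReal ht]
  rw [e, enorm_smul, e2]
  gcongr
  exact enorm_integral_le_lintegral_enorm _

theorem enorm_setAverage_sub_setAverage_le {Ω : Type*} [MeasurableSpace Ω] {μ : Measure Ω}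
    {A B S : Set Ω} {v : Ω → ℝ} (hAS : A ⊆ S) (hBS : B ⊆ S) (hA0 : μ A ≠ 0) (hB0 : μ B ≠ 0)
    (hS : μ S ≠ ⊤) (hv : IntegrableOn v S μ) :
    ‖(⨍ x in A, v x ∂μ) - ⨍ x in B, v x ∂μ‖ₑ
      ≤ (μ A)⁻¹ * ((μ B)⁻¹ * ∫⁻ x in S, ∫⁻ y in S, ‖v x - v y‖ₑ ∂μ ∂μ) := by
  have hAt : μ A ≠ ⊤ := ((measure_mono hAS).trans_lt hS.lt_top).ne
  have hBt : μ B ≠ ⊤ := ((measure_mono hBS).trans_lt hS.lt_top).ne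
  refine (enorm_setAverage_sub_le hA0 hAt (hv.mono_set hAS) _).trans ?_
  gcongr
  calc ∫⁻ x in A, ‖v x - ⨍ y in B, v y ∂μ‖ₑ ∂μ
      ≤ ∫⁻ x in S, (μ B)⁻¹ * ∫⁻ y in S, ‖v x - v y‖ₑ ∂μ ∂μ := by
        refine (lintegral_mono_set hAS).trans (lintegral_mono fun x => ?_)
        rw [enorm_sub_rev]
        refine (enorm_setAverage_sub_le hB0 hBt (hv.mono_set hBS) _).trans ?_
        refine mul_le_mul_right ?_ _
        simp_rw [enorm_sub_rev (v x)]
        exact lintegral_mono_set hBS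
    _ = _ := lintegral_const_mul' _ _ (ENNReal.inv_ne_top.2 hB0)

theorem sum_mul_setLIntegral_le {Ω ι : Type*} [MeasurableSpace Ω] {μ : Measure Ω} {D : Set Ω}
    (I : Finset ι) {S : ι → Set Ω} (hS : ∀ i ∈ I, MeasurableSet (S i)) (hSD : ∀ i ∈ I, S i ⊆ D)
    (a : ι → ℝ≥0∞) {g k : Ω → ℝ≥0∞} (hg : AEMeasurable g (μ.restrict D))
    (h : ∀ᵐ y ∂μ.restrict D, ∑ i ∈ I, (S i).indicator (fun _ => a i) y ≤ k y) :
    ∑ i ∈ I, a i * ∫⁻ y in S i, g y ∂μ ≤ ∫⁻ y in D, g y * k y ∂μ := by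
  calc ∑ i ∈ I, a i * ∫⁻ y in S i, g y ∂μ
      = ∑ i ∈ I, ∫⁻ y in D, g y * (S i).indicator (fun _ => a i) y ∂μ := by
        refine Finset.sum_congr rfl fun i hi => ?_
        have e : ∀ y, g y * (S i).indicator (fun _ => a i) y
            = (S i).indicator (fun y => a i * g y) y := fun y => by
          by_cases hy : y ∈ S i <;> simp [hy, mul_comm]
        simp_rw [e]
        rw [setLIntegral_indicator (hS i hi), inter_eq_left.2 (hSD i hi),
          lintegral_const_mul'' _ (hg.mono_measure (Measure.restrict_mono (hSD i hi) le_rfl))]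
    _ = ∫⁻ y in D, ∑ i ∈ I, g y * (S i).indicator (fun _ => a i) y ∂μ := by
        refine (lintegral_finsetSum' (f := fun i y => g y * (S i).indicator (fun _ => a i) y) _
          fun i hi => ?_).symm
        exact hg.mul (measurable_const.indicator (hS i hi)).aemeasurable
    _ ≤ ∫⁻ y in D, g y * k y ∂μ := by
        refine lintegral_mono_ae ?_
        filter_upwards [h] with y hy
        rw [← Finset.mul_sum]
        gcongr

end Averages

/-! ### The pointwise estimate on John domains -/

section Pointwise

open Filter Topology

variable {n : ℕ}

/-- `v` satisfies the Poincaré inequality with upper gradient `g` on all balls that are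
compactly contained in `D`. -/
def HasBallPoincare (v : EuclideanSpace ℝ (Fin n) → ℝ) (g : EuclideanSpace ℝ (Fin n) → ℝ≥0∞)
    (D : Set (EuclideanSpace ℝ (Fin n))) : Prop :=
  ∀ (z : EuclideanSpace ℝ (Fin n)) (r : ℝ), Metric.closedBall z r ⊆ D →
    ∫⁻ x in Metric.ball z r, ∫⁻ y in Metric.ball z r, ‖v x - v y‖ₑ
      ≤ 2 ^ (n + 1) * ENNReal.ofReal r * volume (Metric.ball z r) * ∫⁻ y in Metric.ball z r, g y

/-- The constant in the comparison of averages over comparable balls. -/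
noncomputable def averageConst (n : ℕ) : ℝ :=
  2 ^ (n + 1) * 16 ^ n / volume.real (Metric.ball (0 : EuclideanSpace ℝ (Fin n)) 1)

theorem volume_real_unitBall_pos :
    0 < volume.real (Metric.ball (0 : EuclideanSpace ℝ (Fin n)) 1) :=
  ENNReal.toReal_pos (Metric.measure_ball_pos _ _ one_pos).ne' measure_ball_lt_top.ne

theorem averageConst_pos : 0 < averageConst n := by
  have := volume_real_unitBall_pos (n := n)
  unfold averageConst
  positivity

theorem volume_ball_eq_ofReal (z : EuclideanSpace ℝ (Fin n)) {r : ℝ} (hr : 0 < r) :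
    volume (Metric.ball z r)
      = ENNReal.ofReal (r ^ n * volume.real (Metric.ball (0 : EuclideanSpace ℝ (Fin n)) 1)) := by
  rw [Measure.addHaar_ball_of_pos _ _ hr, finrank_euclideanSpace_fin,
    ENNReal.ofReal_mul (by positivity), measureReal_def,
    ENNReal.ofReal_toReal measure_ball_lt_top.ne]

theorem HasBallPoincare.enorm_average_sub_average_le (hn : 1 ≤ n)
    {D : Set (EuclideanSpace ℝ (Fin n))}
    {v : EuclideanSpace ℝ (Fin n) → ℝ} {g : EuclideanSpace ℝ (Fin n) → ℝ≥0∞}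
    (h : HasBallPoincare v g D) (hv : IntegrableOn v D) {z a b : EuclideanSpace ℝ (Fin n)}
    {r r₁ r₂ : ℝ} (hr : 0 < r) (hzD : Metric.closedBall z r ⊆ D) (hr₁ : r / 4 ≤ r₁)
    (hr₂ : r / 4 ≤ r₂) (ha : Metric.ball a r₁ ⊆ Metric.ball z r)
    (hb : Metric.ball b r₂ ⊆ Metric.ball z r) :
    ‖(⨍ x in Metric.ball a r₁, v x) - ⨍ x in Metric.ball b r₂, v x‖ₑ
      ≤ ENNReal.ofReal (averageConst n) *
        (ENNReal.ofReal ((r ^ (n - 1))⁻¹) * ∫⁻ y in Metric.ball z r, g y) := by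
  have hw := volume_real_unitBall_pos (n := n)
  set w := volume.real (Metric.ball (0 : EuclideanSpace ℝ (Fin n)) 1) with hwdef
  have hlow : ∀ (c : EuclideanSpace ℝ (Fin n)) (r' : ℝ), r / 4 ≤ r' →
      (volume (Metric.ball c r'))⁻¹ ≤ ENNReal.ofReal (((r / 4) ^ n * w)⁻¹) := by
    intro c r' hr'
    have : ENNReal.ofReal (((r / 4) ^ n * w)⁻¹) = (volume (Metric.ball c (r / 4)))⁻¹ := by
      rw [volume_ball_eq_ofReal c (by positivity), ENNReal.ofReal_inv_of_pos (by positivity)]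
    rw [this]
    exact ENNReal.inv_le_inv.2 (measure_mono (Metric.ball_subset_ball hr'))
  have hr₁0 : 0 < r₁ := by linarith
  have hr₂0 : 0 < r₂ := by linarith
  calc ‖(⨍ x in Metric.ball a r₁, v x) - ⨍ x in Metric.ball b r₂, v x‖ₑ
      ≤ (volume (Metric.ball a r₁))⁻¹ * ((volume (Metric.ball b r₂))⁻¹ *
          ∫⁻ x in Metric.ball z r, ∫⁻ y in Metric.ball z r, ‖v x - v y‖ₑ) :=
        enorm_setAverage_sub_setAverage_le ha hb (Metric.measure_ball_pos _ _ hr₁0).ne'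
          (Metric.measure_ball_pos _ _ hr₂0).ne' measure_ball_lt_top.ne
          (hv.mono_set (Metric.ball_subset_closedBall.trans hzD))
    _ ≤ ENNReal.ofReal (((r / 4) ^ n * w)⁻¹) * (ENNReal.ofReal (((r / 4) ^ n * w)⁻¹) *
          (ENNReal.ofReal (2 ^ (n + 1)) * ENNReal.ofReal r * ENNReal.ofReal (r ^ n * w)
            * ∫⁻ y in Metric.ball z r, g y)) := by
        gcongr
        · exact hlow _ _ hr₁
        · exact hlow _ _ hr₂
        · refine (h z r hzD).trans_eq ?_
          rw [volume_ball_eq_ofReal z hr, ENNReal.ofReal_pow two_pos.le, ENNReal.ofReal_ofNat]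
    _ = ENNReal.ofReal (averageConst n) *
        (ENNReal.ofReal ((r ^ (n - 1))⁻¹) * ∫⁻ y in Metric.ball z r, g y) := by
        simp only [← mul_assoc]
        congr 1
        rw [← ENNReal.ofReal_mul (by positivity), ← ENNReal.ofReal_mul (by positivity),
          ← ENNReal.ofReal_mul (by positivity), ← ENNReal.ofReal_mul (by positivity),
          ← ENNReal.ofReal_mul averageConst_pos.le]
        congr 1
        obtain ⟨m, rfl⟩ : ∃ m, n = m + 1 := ⟨n - 1, by omega⟩
        rw [averageConst, ← hwdef, Nat.add_sub_cancel, div_pow]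
        have : (16 : ℝ) ^ (m + 1) = 4 ^ (m + 1) * 4 ^ (m + 1) := by
          rw [← mul_pow]; norm_num
        rw [this]
        field_simp
        ring

theorem HasBallPoincare.enorm_sub_average_le_riesz (hn : 2 ≤ n)
    {D : Set (EuclideanSpace ℝ (Fin n))}
    {v : EuclideanSpace ℝ (Fin n) → ℝ} {g : EuclideanSpace ℝ (Fin n) → ℝ≥0∞}
    (h : HasBallPoincare v g D) (hv : IntegrableOn v D) (hg : AEMeasurable g (volume.restrict D))
    {x : EuclideanSpace ℝ (Fin n)} {ρ : ℝ} (hρ : 0 < ρ) (hxD : Metric.closedBall x ρ ⊆ D)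
    (hlim : Tendsto (fun k : ℕ => ⨍ y in Metric.ball x (ρ / 2 ^ k), v y) atTop (𝓝 (v x))) :
    ‖v x - ⨍ y in Metric.ball x ρ, v y‖ₑ ≤ ENNReal.ofReal (averageConst n) *
      ∫⁻ y in D, g y * ENNReal.ofReal (2 * (dist x y ^ (n - 1))⁻¹) := by
  have hfin : ∀ K : ℕ, ‖(⨍ y in Metric.ball x (ρ / 2 ^ K), v y) - ⨍ y in Metric.ball x ρ, v y‖ₑ
      ≤ ENNReal.ofReal (averageConst n) *
        ∑ k ∈ Finset.range K, ENNReal.ofReal (((ρ / 2 ^ k) ^ (n - 1))⁻¹) *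
          ∫⁻ y in Metric.ball x (ρ / 2 ^ k), g y := by
    intro K
    induction K with
    | zero => simp
    | succ K ih =>
      have hsplit := enorm_add_le
        ((⨍ y in Metric.ball x (ρ / 2 ^ (K + 1)), v y) - ⨍ y in Metric.ball x (ρ / 2 ^ K), v y)
        ((⨍ y in Metric.ball x (ρ / 2 ^ K), v y) - ⨍ y in Metric.ball x ρ, v y)
      rw [sub_add_sub_cancel] at hsplit
      refine hsplit.trans ?_
      rw [Finset.sum_range_succ, mul_add, add_comm (_ * _)]
      refine add_le_add ?_ ih
      have hpos : 0 < ρ / 2 ^ K := by positivity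
      have hle : ρ / 2 ^ K ≤ ρ := div_le_self hρ.le (one_le_pow₀ one_le_two)
      have hhalf : ρ / 2 ^ (K + 1) = ρ / 2 ^ K / 2 := by rw [pow_succ, div_div]
      exact h.enorm_average_sub_average_le (by omega) hv hpos
        ((Metric.closedBall_subset_closedBall hle).trans hxD) (by rw [hhalf]; linarith)
        (by linarith) (Metric.ball_subset_ball (by rw [hhalf]; linarith)) subset_rfl
  refine le_of_tendsto ((hlim.sub_const _).enorm) (Eventually.of_forall fun K => ?_)
  refine (hfin K).trans ?_
  gcongr
  refine sum_mul_setLIntegral_le _ (fun _ _ => Metric.isOpen_ball.measurableSet)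
    (fun k _ => ?_) _ hg ?_
  · refine (Metric.ball_subset_closedBall.trans
      (Metric.closedBall_subset_closedBall ?_)).trans hxD
    exact div_le_self hρ.le (one_le_pow₀ one_le_two)
  · have : Nontrivial (EuclideanSpace ℝ (Fin n)) := by
      have : NeZero n := ⟨by omega⟩
      infer_instance
    filter_upwards [ae_restrict_of_ae (Measure.ae_ne volume x)] with y hy
    have hr : 0 < dist x y := dist_pos.2 (Ne.symm hy)
    have e : ∀ k ∈ Finset.range K, (Metric.ball x (ρ / 2 ^ k)).indicator
        (fun _ => ENNReal.ofReal (((ρ / 2 ^ k) ^ (n - 1))⁻¹)) y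
        = ENNReal.ofReal (if dist x y < ρ / 2 ^ k then ((ρ / 2 ^ k) ^ (n - 1))⁻¹ else 0) := by
      intro k _
      by_cases hk : dist x y < ρ / 2 ^ k
      · rw [if_pos hk, indicator_of_mem (Metric.mem_ball'.2 hk)]
      · rw [if_neg hk, indicator_of_notMem (fun h => hk (Metric.mem_ball'.1 h)),
          ENNReal.ofReal_zero]
    rw [Finset.sum_congr rfl e, ← ENNReal.ofReal_sum_of_nonneg]
    · exact ENNReal.ofReal_le_ofReal (sum_indicator_dyadic_le hr hρ (by omega) K)
    · intro k _
      split_ifs <;> positivity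

theorem HasUnitSpeedOn.dist_le {X : Type*} [PseudoMetricSpace X] {γ : ℝ → X} {S : Set ℝ}
    (h : HasUnitSpeedOn γ S) {a b : ℝ} (ha : a ∈ S) (hb : b ∈ S) :
    dist (γ a) (γ b) ≤ |a - b| := by
  wlog hab : a ≤ b generalizing a b
  · rw [dist_comm, abs_sub_comm]
    exact this hb ha (le_of_not_ge hab)
  have h1 := eVariationOn.edist_le γ (s := S ∩ Icc a b) ⟨ha, le_rfl, hab⟩ ⟨hb, hab, le_rfl⟩
  rw [h ha hb, NNReal.coe_one, one_mul, edist_dist,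
    ENNReal.ofReal_le_ofReal_iff (by linarith)] at h1
  rw [abs_sub_comm, abs_of_nonneg (by linarith)]
  exact h1

section John

variable {D : Set (EuclideanSpace ℝ (Fin n))} {s : EuclideanSpace ℝ (Fin n) → ℝ} {α β : ℝ}
  {x₀ : EuclideanSpace ℝ (Fin n)}

theorem IsJohnDomain.beta_pos (hJ : IsJohnDomain D s α β x₀) : 0 < β :=
  hJ.alpha_pos.trans_le hJ.alpha_le_beta

theorem IsJohnDomain.dist_center_le (hJ : IsJohnDomain D s α β x₀) {x : EuclideanSpace ℝ (Fin n)}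
    (hx : x ∈ D) : dist x x₀ ≤ β := by
  obtain ⟨ℓ, γ, h0, hβ, hγ, -, rfl, rfl, -⟩ := hJ.exists_curve x hx
  have := hγ.dist_le (left_mem_Icc.2 h0) (right_mem_Icc.2 h0)
  rw [zero_sub, abs_neg, abs_of_nonneg h0] at this
  exact this.trans hβ

theorem IsJohnDomain.dist_le (hJ : IsJohnDomain D s α β x₀) {x y : EuclideanSpace ℝ (Fin n)}
    (hx : x ∈ D) (hy : y ∈ D) : dist x y ≤ 2 * β := by
  linarith [dist_triangle_right x y x₀, hJ.dist_center_le hx, hJ.dist_center_le hy]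

theorem IsJohnDomain.frontier_nonempty (hJ : IsJohnDomain D s α β x₀) (hn : 1 ≤ n) :
    (frontier D).Nonempty := by
  have : NeZero n := ⟨by omega⟩
  refine nonempty_frontier_iff.2 ⟨hJ.isConnected.nonempty, fun h => ?_⟩
  have := hJ.isBounded
  rw [h] at this
  exact NormedSpace.unbounded_univ ℝ (EuclideanSpace ℝ (Fin n)) this

theorem IsJohnDomain.infDist_frontier_le (hJ : IsJohnDomain D s α β x₀)
    {x : EuclideanSpace ℝ (Fin n)} (hx : x ∈ D) : Metric.infDist x (frontier D) ≤ 2 * β := by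
  rcases (frontier D).eq_empty_or_nonempty with h | ⟨y, hy⟩
  · rw [h, Metric.infDist_empty]; linarith [hJ.beta_pos]
  · refine (Metric.infDist_le_dist_of_mem hy).trans ?_
    have hsub : D ⊆ Metric.closedBall x₀ β := fun z hz => hJ.dist_center_le hz
    have h1 : dist y x₀ ≤ β :=
      closure_minimal hsub Metric.isClosed_closedBall (frontier_subset_closure hy)
    linarith [dist_triangle_right x y x₀, hJ.dist_center_le hx]

theorem IsJohnDomain.infDist_frontier_pos (hJ : IsJohnDomain D s α β x₀) (hn : 1 ≤ n)
    {x : EuclideanSpace ℝ (Fin n)} (hx : x ∈ D) : 0 < Metric.infDist x (frontier D) := by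
  refine (isClosed_frontier.notMem_iff_infDist_pos (hJ.frontier_nonempty hn)).1 fun h => ?_
  rw [hJ.isOpen.frontier_eq] at h
  exact h.2 hx

theorem inv_pow_le_mul_rpow_neg {r t R B M σ : ℝ} (m : ℕ) (hr : 0 < r) (ht : 0 ≤ t) (hR : 0 < R)
    (hM : 1 ≤ M) (hσ : 1 ≤ σ) (hσ2 : σ ≤ 2) (hRt : R ≤ t + r) (htr : t ^ σ ≤ B * r)
    (hrM : r ≤ M) :
    (r ^ m)⁻¹ ≤ (4 * (B + M)) ^ m * R ^ (-(σ * m)) := by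
  have h1 : R ^ σ ≤ 4 * (B + M) * r := by
    have hmax : 0 ≤ max t r := ht.trans (le_max_left _ _)
    have hrσ : r ^ σ ≤ M * r := by
      calc r ^ σ = r ^ (σ - 1) * r := by
            rw [← Real.rpow_add_one hr.ne', sub_add_cancel]
        _ ≤ M ^ (σ - 1) * r := by
            gcongr
        _ ≤ M ^ (1 : ℝ) * r := by
            gcongr
            · linarith
        _ = M * r := by rw [Real.rpow_one]
    calc R ^ σ ≤ (2 * max t r) ^ σ := by
          gcongr
          linarith [le_max_left t r, le_max_right t r]
      _ = 2 ^ σ * (max t r) ^ σ := Real.mul_rpow two_pos.le hmax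
      _ ≤ 4 * (t ^ σ + r ^ σ) := by
          gcongr
          · calc (2 : ℝ) ^ σ ≤ 2 ^ (2 : ℝ) := by gcongr; norm_num
              _ = 4 := by norm_num
          · have := Real.rpow_nonneg ht σ
            have := Real.rpow_nonneg hr.le σ
            rcases max_cases t r with ⟨h, -⟩ | ⟨h, -⟩ <;> rw [h] <;> linarith
      _ ≤ 4 * (B + M) * r := by linarith
  have hRσ : 0 < R ^ σ := Real.rpow_pos_of_pos hR σ
  have h2 : R ^ (-(σ * m)) = ((R ^ σ) ^ m)⁻¹ := by
    rw [Real.rpow_neg hR.le, Real.rpow_mul hR.le, Real.rpow_natCast]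
  rw [h2, ← div_eq_mul_inv, inv_eq_one_div, div_le_div_iff₀ (by positivity) (by positivity),
    one_mul, ← mul_pow]
  gcongr

/-- The John curve from `x` to the center yields a chain of balls with bounded overlap, along
which the averages are controlled by a potential. -/
theorem IsJohnDomain.enorm_average_sub_average_center_le (hn : 2 ≤ n)
    (hJ : IsJohnDomain D s α β x₀)
    {v : EuclideanSpace ℝ (Fin n) → ℝ} {g : EuclideanSpace ℝ (Fin n) → ℝ≥0∞}
    (h : HasBallPoincare v g D) (hv : IntegrableOn v D) (hg : AEMeasurable g (volume.restrict D))
    {x : EuclideanSpace ℝ (Fin n)} (hx : x ∈ D) (hs : s x ≤ 2) :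
    ‖(⨍ y in Metric.ball x (Metric.infDist x (frontier D) / 4), v y)
        - ⨍ y in Metric.ball x₀ (Metric.infDist x₀ (frontier D) / 4), v y‖ₑ
      ≤ ENNReal.ofReal (averageConst n) * ∫⁻ y in D, g y * ENNReal.ofReal
        (43 ^ n * ((4 * (2 * (β / α) + (1 + 2 * β))) ^ (n - 1) *
          dist x y ^ (-(s x * (n - 1 : ℕ))))) := by
  obtain ⟨ℓ, γ, h0, hℓβ, hγ, hγD, rfl, rfl, hJγ⟩ := hJ.exists_curve x hx
  have hβ := hJ.beta_pos
  have hα := hJ.alpha_pos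
  set d : EuclideanSpace ℝ (Fin n) → ℝ := fun y => Metric.infDist y (frontier D) with hd
  have hdL : ∀ a b, d a ≤ d b + dist a b := fun a b => Metric.infDist_le_infDist_add_dist
  have hdc : Continuous d := Metric.continuous_infDist_pt _
  have hdpos : ∀ t ∈ Icc 0 ℓ, 0 < d (γ t) := fun t ht =>
    hJ.infDist_frontier_pos (by omega) (hγD ht)
  have hLip : ∀ a ∈ Icc 0 ℓ, ∀ b ∈ Icc 0 ℓ, dist (γ a) (γ b) ≤ |a - b| := fun a ha b hb =>
    hγ.dist_le ha hb
  have hγc : ContinuousOn γ (Icc 0 ℓ) := by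
    refine LipschitzOnWith.continuousOn (K := 1)
      (LipschitzOnWith.of_dist_le_mul fun a ha b hb => ?_)
    rw [NNReal.coe_one, one_mul, Real.dist_eq]
    exact hLip a ha b hb
  obtain ⟨τ, hτ, hmin⟩ := isCompact_Icc.exists_isMinOn ⟨0, left_mem_Icc.2 h0⟩
    (hdc.comp_continuousOn hγc)
  obtain ⟨N, t, htI, ht0, htN, hnext, hsep⟩ := exists_lastExit_chain h0 hLip
    (ρ := fun t => d (γ t) / 4) (ε := d (γ τ) / 4) (by linarith [hdpos τ hτ])
    (fun t ht => by
      have : d (γ τ) ≤ d (γ t) := hmin ht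
      linarith)
  have hpos : ∀ i, 0 < d (γ (t i)) := fun i => hdpos _ (htI i)
  have hballD : ∀ i, Metric.closedBall (γ (t i)) (3 / 4 * d (γ (t i))) ⊆ D := fun i =>
    (Metric.closedBall_subset_ball (by linarith [hpos i])).trans
      (hJ.isOpen.ball_infDist_frontier_subset (hγD (htI i)))
  have hchain : ∀ K : ℕ, ‖(⨍ y in Metric.ball (γ (t 0)) (d (γ (t 0)) / 4), v y)
      - ⨍ y in Metric.ball (γ (t K)) (d (γ (t K)) / 4), v y‖ₑ
      ≤ ENNReal.ofReal (averageConst n) * ∑ i ∈ Finset.range K,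
        ENNReal.ofReal (((3 / 4 * d (γ (t i))) ^ (n - 1))⁻¹) *
          ∫⁻ y in Metric.ball (γ (t i)) (3 / 4 * d (γ (t i))), g y := by
    intro K
    induction K with
    | zero => simp
    | succ K ih =>
      have hsplit := enorm_add_le ((⨍ y in Metric.ball (γ (t 0)) (d (γ (t 0)) / 4), v y)
        - ⨍ y in Metric.ball (γ (t K)) (d (γ (t K)) / 4), v y)
        ((⨍ y in Metric.ball (γ (t K)) (d (γ (t K)) / 4), v y)
        - ⨍ y in Metric.ball (γ (t (K + 1))) (d (γ (t (K + 1))) / 4), v y)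
      rw [sub_add_sub_cancel] at hsplit
      refine hsplit.trans ?_
      rw [Finset.sum_range_succ, mul_add]
      refine add_le_add ih ?_
      have hK := hpos K
      have h1 := hnext K
      have h2 := hdL (γ (t (K + 1))) (γ (t K))
      have h3 := hdL (γ (t K)) (γ (t (K + 1)))
      rw [dist_comm] at h3
      exact h.enorm_average_sub_average_le (by omega) hv (by linarith) (hballD K)
        (by linarith) (by linarith) (Metric.ball_subset_ball (by linarith))
        (Metric.ball_subset_ball' (by linarith))
  have hfin := hchain N
  rw [ht0, htN] at hfin
  refine hfin.trans ?_
  gcongr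
  refine sum_mul_setLIntegral_le _ (fun _ _ => Metric.isOpen_ball.measurableSet)
    (fun i _ => Metric.ball_subset_closedBall.trans (hballD i)) _ hg ?_
  have : NeZero n := ⟨by omega⟩
  filter_upwards [ae_restrict_of_ae (Measure.ae_ne volume (γ 0))] with y hy
  have hR : 0 < dist (γ 0) y := dist_pos.2 (Ne.symm hy)
  classical
  set I : Finset ℕ := {i ∈ Finset.range N | y ∈ Metric.ball (γ (t i)) (3 / 4 * d (γ (t i)))}
    with hI
  have hcard : I.card ≤ 43 ^ n := by
    have := card_filter_mem_ball_le hdL (p := fun i => γ (t i)) hpos hsep y I fun i hi => by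
      rw [hI, Finset.mem_filter, Finset.mem_range] at hi
      exact ⟨hi.1, hi.2⟩
    rwa [finrank_euclideanSpace_fin] at this
  set b : ℝ := (4 * (2 * (β / α) + (1 + 2 * β))) ^ (n - 1) *
    dist (γ 0) y ^ (-(s (γ 0) * (n - 1 : ℕ))) with hb
  have hb0 : 0 ≤ b := by positivity
  calc ∑ i ∈ Finset.range N, (Metric.ball (γ (t i)) (3 / 4 * d (γ (t i)))).indicator
        (fun _ => ENNReal.ofReal (((3 / 4 * d (γ (t i))) ^ (n - 1))⁻¹)) y
      = ∑ i ∈ I, ENNReal.ofReal (((3 / 4 * d (γ (t i))) ^ (n - 1))⁻¹) := by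
        rw [hI, Finset.sum_filter]
        refine Finset.sum_congr rfl fun i _ => ?_
        rw [indicator_apply]
    _ ≤ ∑ i ∈ I, ENNReal.ofReal b := by
        refine Finset.sum_le_sum fun i hi => ENNReal.ofReal_le_ofReal ?_
        rw [hI, Finset.mem_filter] at hi
        have hyi : dist y (γ (t i)) < 3 / 4 * d (γ (t i)) := hi.2
        have hti : dist (γ 0) (γ (t i)) ≤ t i := by
          have := hLip 0 (left_mem_Icc.2 h0) (t i) (htI i)
          rwa [zero_sub, abs_neg, abs_of_nonneg (htI i).1] at this
        refine inv_pow_le_mul_rpow_neg (t := t i) (n - 1) (by linarith [hpos i]) (htI i).1 hR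
          (by linarith) (hJ.one_le _ hx) hs ?_ ?_ ?_
        · linarith [dist_triangle_right (γ 0) y (γ (t i))]
        · have h1 : t i ^ s (γ 0) ≤ β / α * d (γ (t i)) := hJγ (t i) (htI i)
          have h2 : 0 ≤ β / α * d (γ (t i)) := mul_nonneg (by positivity) (hpos i).le
          linarith
        · have : d (γ (t i)) ≤ 2 * β := hJ.infDist_frontier_le (hγD (htI i))
          linarith [hpos i]
    _ = (I.card : ℝ≥0∞) * ENNReal.ofReal b := by rw [Finset.sum_const, nsmul_eq_mul]
    _ ≤ ENNReal.ofReal (43 ^ n * b) := by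
        rw [ENNReal.ofReal_mul (p := 43 ^ n) (by positivity)]
        refine mul_le_mul_left ?_ _
        rw [ENNReal.ofReal_pow (by norm_num), ENNReal.ofReal_ofNat]
        exact_mod_cast hcard

/-- The potential estimate for functions that satisfy the Poincaré inequality on balls. -/
theorem IsJohnDomain.ae_enorm_sub_average_le (hn : 2 ≤ n) (hJ : IsJohnDomain D s α β x₀)
    (hs : ∀ x ∈ D, s x ≤ 2)
    {v : EuclideanSpace ℝ (Fin n) → ℝ} {g : EuclideanSpace ℝ (Fin n) → ℝ≥0∞}
    (h : HasBallPoincare v g D) (hv : IntegrableOn v D)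
    (hg : AEMeasurable g (volume.restrict D)) :
    ∀ᵐ x ∂volume.restrict D,
      ‖v x - ⨍ y in Metric.ball x₀ (Metric.infDist x₀ (frontier D) / 4), v y‖ₑ
        ≤ ENNReal.ofReal (averageConst n *
            ((2 + 43 ^ n) * (4 * (2 * (β / α) + (1 + 2 * β))) ^ (n - 1))) *
          ∫⁻ y in D, g y * ENNReal.ofReal (dist x y ^ (-(s x * (n - 1 : ℕ)))) := by
  have hβ := hJ.beta_pos
  have hα := hJ.alpha_pos
  have hvi : Integrable (D.indicator v) := hv.integrable_indicator hJ.isOpen.measurableSet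
  have hleb := IsUnifLocDoublingMeasure.ae_tendsto_average (μ := volume)
    hvi.locallyIntegrable 1
  filter_upwards [ae_restrict_of_ae hleb, ae_restrict_mem hJ.isOpen.measurableSet] with x hx hxD
  set ρ := Metric.infDist x (frontier D) / 4 with hρ
  have hpos : 0 < Metric.infDist x (frontier D) := hJ.infDist_frontier_pos (by omega) hxD
  have hρ0 : 0 < ρ := by positivity
  have hballD : Metric.closedBall x ρ ⊆ D :=
    (Metric.closedBall_subset_ball (by rw [hρ]; linarith)).trans
      (hJ.isOpen.ball_infDist_frontier_subset hxD)
  have hlim : Tendsto (fun k : ℕ => ⨍ y in Metric.ball x (ρ / 2 ^ k), v y) atTop (𝓝 (v x)) := by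
    have hδ : Tendsto (fun k : ℕ => ρ / 2 ^ k) atTop (𝓝[>] 0) := by
      refine tendsto_nhdsWithin_iff.2 ⟨?_, Eventually.of_forall fun k => ?_⟩
      · have := (tendsto_pow_atTop_nhds_zero_of_lt_one (r := (1 / 2 : ℝ)) (by norm_num)
          (by norm_num)).const_mul ρ
        simpa [div_eq_mul_inv] using this
      · exact mem_Ioi.2 (by positivity)
    have h1 := hx (fun _ : ℕ => x) (fun k => ρ / 2 ^ k) hδ
      (Eventually.of_forall fun k => Metric.mem_closedBall_self (by positivity))
    rw [indicator_of_mem hxD] at h1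
    refine h1.congr fun k => ?_
    have : NeZero n := ⟨by omega⟩
    have hae : (Metric.ball x (ρ / 2 ^ k) : Set _) =ᵐ[volume] Metric.closedBall x (ρ / 2 ^ k) :=
      ae_eq_of_subset_of_measure_ge Metric.ball_subset_closedBall
        (Measure.addHaar_closedBall_eq_addHaar_ball _ _ _ ).le
        Metric.isOpen_ball.measurableSet.nullMeasurableSet measure_closedBall_lt_top.ne
    rw [← setAverage_congr hae]
    have hsub : Metric.ball x (ρ / 2 ^ k) ⊆ D :=
      (Metric.ball_subset_closedBall.trans (Metric.closedBall_subset_closedBall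
        (div_le_self hρ0.le (one_le_pow₀ one_le_two)))).trans hballD
    exact setAverage_congr_fun Metric.isOpen_ball.measurableSet
      (ae_of_all _ fun y hy => indicator_of_mem (hsub hy) v)
  have hA : 0 ≤ (4 * (2 * (β / α) + (1 + 2 * β))) ^ (n - 1) := by positivity
  set A : ℝ := (4 * (2 * (β / α) + (1 + 2 * β))) ^ (n - 1) with hAdef
  have h1 := h.enorm_sub_average_le_riesz hn hv hg hρ0 hballD hlim
  have h2 := hJ.enorm_average_sub_average_center_le hn h hv hg hxD (hs x hxD)
  set k : EuclideanSpace ℝ (Fin n) → ℝ := fun y => dist x y ^ (-(s x * (n - 1 : ℕ))) with hk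
  have hk0 : ∀ y, 0 ≤ k y := fun y => Real.rpow_nonneg dist_nonneg _
  have hcm : ∀ c : ℝ, 0 ≤ c → ∫⁻ y in D, g y * ENNReal.ofReal (c * k y)
      = ENNReal.ofReal c * ∫⁻ y in D, g y * ENNReal.ofReal (k y) := by
    intro c hc
    rw [← lintegral_const_mul' _ _ ENNReal.ofReal_ne_top]
    refine lintegral_congr fun y => ?_
    rw [ENNReal.ofReal_mul hc, mul_left_comm]
  have hsplit := enorm_add_le (v x - ⨍ y in Metric.ball x ρ, v y)
    ((⨍ y in Metric.ball x ρ, v y)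
      - ⨍ y in Metric.ball x₀ (Metric.infDist x₀ (frontier D) / 4), v y)
  rw [sub_add_sub_cancel] at hsplit
  refine hsplit.trans ((add_le_add h1 h2).trans ?_)
  have h3 : ∫⁻ y in D, g y * ENNReal.ofReal (2 * (dist x y ^ (n - 1))⁻¹)
      ≤ ∫⁻ y in D, g y * ENNReal.ofReal (2 * A * k y) := by
    have : NeZero n := ⟨by omega⟩
    refine lintegral_mono_ae ?_
    filter_upwards [ae_restrict_of_ae (Measure.ae_ne volume x),
      ae_restrict_mem hJ.isOpen.measurableSet] with y hy hyD
    have hR : 0 < dist x y := dist_pos.2 (Ne.symm hy)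
    refine mul_le_mul_right (ENNReal.ofReal_le_ofReal ?_) _
    rw [mul_assoc]
    refine mul_le_mul_of_nonneg_left ?_ two_pos.le
    refine inv_pow_le_mul_rpow_neg (t := 0) (n - 1) hR le_rfl hR (by linarith)
      (hJ.one_le _ hxD) (hs x hxD) (by linarith) ?_ ?_
    · rw [Real.zero_rpow (by linarith [hJ.one_le _ hxD])]
      positivity
    · linarith [hJ.dist_le hxD hyD]
  have h4 : ∫⁻ y in D, g y * ENNReal.ofReal (43 ^ n * (A * dist x y ^ (-(s x * (n - 1 : ℕ)))))
      = ENNReal.ofReal (43 ^ n * A) * ∫⁻ y in D, g y * ENNReal.ofReal (k y) := by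
    rw [← hcm _ (by positivity)]
    simp_rw [mul_assoc, hk]
  rw [hcm _ (by positivity)] at h3
  rw [h4]
  calc _ ≤ ENNReal.ofReal (averageConst n) * (ENNReal.ofReal (2 * A) *
        ∫⁻ y in D, g y * ENNReal.ofReal (k y)) + ENNReal.ofReal (averageConst n) *
        (ENNReal.ofReal (43 ^ n * A) * ∫⁻ y in D, g y * ENNReal.ofReal (k y)) := by gcongr
    _ = _ := by
      rw [ENNReal.ofReal_mul averageConst_pos.le, add_mul, ENNReal.ofReal_add (by positivity)
        (by positivity)]
      ring

end John

end Pointwise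

/-! ### The weak type estimate for the potential with variable kernel -/

section WeakType

variable {n : ℕ}

theorem setLIntegral_ball_rpow_neg_dist (hn : 1 ≤ n) {a R : ℝ} (ha : a < n) (hR : 0 < R)
    (y : EuclideanSpace ℝ (Fin n)) :
    ∫⁻ x in Metric.ball y R, ENNReal.ofReal (dist x y ^ (-a))
      = ENNReal.ofReal (n * volume.real (Metric.ball (0 : EuclideanSpace ℝ (Fin n)) 1) *
        (R ^ (n - a) / (n - a))) := by
  have : NeZero n := ⟨by omega⟩
  set f : ℝ → ℝ := (Iio R).indicator fun r => r ^ (-a) with hf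
  have hpow : ∀ r ∈ Ioo 0 R, r ^ (n - 1) • r ^ (-a) = r ^ ((n : ℝ) - 1 - a) := by
    intro r hr
    have e : (n : ℝ) - 1 - a = ((n - 1 : ℕ) : ℝ) + -a := by
      rw [Nat.cast_sub hn, Nat.cast_one]; ring
    rw [e, Real.rpow_add hr.1, Real.rpow_natCast, smul_eq_mul]
  have hintR : IntegrableOn (fun r : ℝ => r ^ (n - 1) • r ^ (-a)) (Ioo 0 R) := by
    refine IntegrableOn.congr_fun ?_ (fun r hr => (hpow r hr).symm) measurableSet_Ioo
    exact (intervalIntegral.integrableOn_Ioo_rpow_iff hR).2 (by linarith)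
  have hfi : ∀ r ∈ Ioi (0 : ℝ), r ^ (n - 1) • f r
      = (Ioo 0 R).indicator (fun r : ℝ => r ^ (n - 1) • r ^ (-a)) r := by
    intro r hr
    have hr : 0 < r := hr
    by_cases hrR : r < R <;> simp [hf, hrR, hr]
  have hsub : Ioo 0 R ∩ Ioi (0 : ℝ) = Ioo 0 R := inter_eq_left.2 fun r hr => hr.1
  have hInt : Integrable fun x : EuclideanSpace ℝ (Fin n) => f ‖x‖ := by
    rw [integrable_fun_norm_addHaar, finrank_euclideanSpace_fin,
      integrableOn_congr_fun hfi measurableSet_Ioi]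
    exact (hintR.integrable_indicator measurableSet_Ioo).integrableOn
  have hval : ∫ x : EuclideanSpace ℝ (Fin n), f ‖x‖
      = n * volume.real (Metric.ball (0 : EuclideanSpace ℝ (Fin n)) 1) *
        (R ^ (n - a) / (n - a)) := by
    rw [integral_fun_norm_addHaar, finrank_euclideanSpace_fin,
      setIntegral_congr_fun measurableSet_Ioi hfi, integral_indicator measurableSet_Ioo,
      Measure.restrict_restrict measurableSet_Ioo, hsub,
      setIntegral_congr_fun measurableSet_Ioo hpow, ← integral_Ioc_eq_integral_Ioo,
      ← intervalIntegral.integral_of_le hR.le, integral_rpow (Or.inl (by linarith)),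
      Real.zero_rpow (by linarith), sub_zero, nsmul_eq_mul, smul_eq_mul, ← mul_assoc]
    congr 2
    · congr 1; ring
    · ring
  rw [← hval, ofReal_integral_eq_lintegral_ofReal hInt (ae_of_all _ fun x => ?_)]
  · rw [← lintegral_sub_right_eq_self (fun x => ENNReal.ofReal (f ‖x‖)) y,
      ← lintegral_indicator Metric.isOpen_ball.measurableSet]
    refine lintegral_congr fun x => ?_
    by_cases hx : x ∈ Metric.ball y R
    · have : ‖x - y‖ < R := by rw [← dist_eq_norm]; exact hx
      rw [indicator_of_mem hx, hf, indicator_of_mem (mem_Iio.2 this), dist_eq_norm]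
    · have : ¬ ‖x - y‖ < R := by rw [← dist_eq_norm]; exact hx
      rw [indicator_of_notMem hx, hf, indicator_of_notMem (by exact this), ENNReal.ofReal_zero]
  · simp only [Pi.zero_apply, hf, indicator_apply]
    split_ifs
    · exact Real.rpow_nonneg (norm_nonneg x) _
    · exact le_rfl

theorem LogHolderOnWith.rpow_dist_le {D : Set (EuclideanSpace ℝ (Fin n))}
    {s : EuclideanSpace ℝ (Fin n) → ℝ} {L M : ℝ} (hs : LogHolderOnWith L s D)
    {x y : EuclideanSpace ℝ (Fin n)} (hx : x ∈ D) (hy : y ∈ D) (hxy : x ≠ y) (hM : 1 ≤ M)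
    (hdist : dist x y ≤ M) (h1 : |s x - s y| ≤ 1) {κ : ℝ} (hκ : |κ| ≤ |s x - s y|) :
    dist x y ^ κ ≤ M * Real.exp L := by
  have hr : 0 < dist x y := dist_pos.2 hxy
  have hL := hs.1
  have hexp : 1 ≤ Real.exp L := Real.one_le_exp hL.le
  rcases le_or_gt 1 (dist x y) with h | h
  · calc dist x y ^ κ ≤ dist x y ^ (1 : ℝ) :=
          Real.rpow_le_rpow_of_exponent_le h ((le_abs_self κ).trans (hκ.trans h1))
      _ = dist x y := Real.rpow_one _
      _ ≤ M * Real.exp L := by nlinarith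
  · set l := Real.log (1 / dist x y) with hl
    have hl0 : 0 ≤ l := Real.log_nonneg (by rw [le_div_iff₀ hr]; linarith)
    have hle : l ≤ Real.log (Real.exp 1 + 1 / dist x y) :=
      Real.log_le_log (by positivity) (by linarith [Real.exp_pos 1])
    have hpos : 0 < Real.log (Real.exp 1 + 1 / dist x y) := by
      refine Real.log_pos ?_
      have := Real.add_one_le_exp 1
      have : 0 < 1 / dist x y := by positivity
      linarith
    have hlog : |s x - s y| * l ≤ L := by
      have h2 := hs.2 x hx y hy hxy
      rw [le_div_iff₀ hpos] at h2
      exact (mul_le_mul_of_nonneg_left hle (abs_nonneg _)).trans h2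
    calc dist x y ^ κ = Real.exp (-κ * l) := by
          rw [Real.rpow_def_of_pos hr, hl, one_div, Real.log_inv]
          congr 1; ring
      _ ≤ Real.exp L := by
          refine Real.exp_le_exp.2 (le_trans ?_ hlog)
          exact mul_le_mul_of_nonneg_right (((neg_le_abs κ)).trans hκ) hl0
      _ ≤ M * Real.exp L := by nlinarith

/-- Freezing the exponent: where the kernel is large compared to `t`, log-Hölder continuity
allows to replace `σ = s(x)` by `σ' = s(y)`. -/
theorem rpow_neg_mul_rpow_le_of_lt {m : ℕ} (hm : 1 ≤ m) {r t σ σ' Λ : ℝ} (hr : 0 < r) (ht : 1 ≤ t)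
    (hσ : 1 ≤ σ) (hσ' : 1 ≤ σ') (hΛ : 1 ≤ Λ)
    (hfreeze : ∀ κ : ℝ, |κ| ≤ |σ - σ'| → r ^ κ ≤ Λ) (hlarge : t / 2 < r ^ (-(σ * m))) :
    r ^ (-(σ * m)) * t ^ (((m : ℝ) + 1) / (σ * m))
        ≤ Λ ^ m * (2 * Λ) ^ (m + 1) * t ^ (((m : ℝ) + 1) / (σ' * m)) * r ^ (-(σ' * m)) ∧
      r < (2 * Λ ^ m / t) ^ (1 / (σ' * m)) := by
  have hmR : (1 : ℝ) ≤ m := by exact_mod_cast hm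
  have ha : 1 ≤ σ * m := one_le_mul_of_one_le_of_one_le hσ hmR
  have ha' : 1 ≤ σ' * m := one_le_mul_of_one_le_of_one_le hσ' hmR
  have ht0 : 0 < t := by linarith
  have hshift : ∀ κ : ℝ, |κ| ≤ |σ - σ'| → r ^ (κ * m) ≤ Λ ^ m := fun κ hκ => by
    rw [Real.rpow_mul hr.le, Real.rpow_natCast]
    exact pow_le_pow_left₀ (Real.rpow_nonneg hr.le _) (hfreeze κ hκ) m
  have h1 : r ^ (-(σ * m)) ≤ Λ ^ m * r ^ (-(σ' * m)) := by
    have e : -(σ * (m : ℝ)) = (σ' - σ) * m + -(σ' * m) := by ring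
    rw [e, Real.rpow_add hr]
    gcongr
    exact hshift _ (by rw [abs_sub_comm])
  have h2 : t ^ (((m : ℝ) + 1) / (σ * m))
      ≤ (2 * Λ) ^ (m + 1) * t ^ (((m : ℝ) + 1) / (σ' * m)) := by
    set q := ((m : ℝ) + 1) / (σ * m) with hq
    set q' := ((m : ℝ) + 1) / (σ' * m) with hq'
    have hq'0 : 0 ≤ q' := by positivity
    have hqm : q ≤ m + 1 := div_le_self (by positivity) ha
    rcases le_total q q' with h | h
    · have h3 : t ^ q ≤ t ^ q' := Real.rpow_le_rpow_of_exponent_le ht h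
      have h4 : 1 ≤ (2 * Λ) ^ (m + 1) := one_le_pow₀ (by linarith)
      have h5 : 0 ≤ t ^ q' := by positivity
      nlinarith
    · have e : t ^ q = t ^ (q - q') * t ^ q' := by
        rw [← Real.rpow_add ht0, sub_add_cancel]
      rw [e]
      gcongr
      have hd : 0 ≤ q - q' := by linarith
      calc t ^ (q - q') ≤ (2 * r ^ (-(σ * m))) ^ (q - q') := by
            gcongr
            linarith
        _ = 2 ^ (q - q') * (r ^ ((σ - σ') / σ')) ^ (m + 1) := by
            rw [Real.mul_rpow two_pos.le (by positivity), ← Real.rpow_mul hr.le,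
              ← Real.rpow_natCast (r ^ _), ← Real.rpow_mul hr.le]
            congr 2
            rw [hq, hq']
            push_cast
            field_simp
            ring
        _ ≤ 2 ^ ((m : ℝ) + 1) * Λ ^ (m + 1) := by
            gcongr
            · norm_num
            · linarith
            · refine hfreeze _ ?_
              rw [abs_div, abs_of_pos (by linarith : 0 < σ')]
              exact div_le_self (abs_nonneg _) hσ'
        _ = (2 * Λ) ^ (m + 1) := by
            rw [mul_pow]
            congr 1
            exact_mod_cast Real.rpow_natCast 2 (m + 1)
  constructor
  · calc r ^ (-(σ * m)) * t ^ (((m : ℝ) + 1) / (σ * m))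
        ≤ (Λ ^ m * r ^ (-(σ' * m))) * ((2 * Λ) ^ (m + 1) * t ^ (((m : ℝ) + 1) / (σ' * m))) := by
          gcongr
      _ = _ := by ring
  · have h3 : r ^ (σ' * m) < 2 * Λ ^ m / t := by
      have e : r ^ (σ' * m) = r ^ ((σ' - σ) * m) * r ^ (σ * m) := by
        rw [← Real.rpow_add hr]; congr 1; ring
      have h4 : r ^ (σ * m) < 2 / t := by
        rw [Real.rpow_neg hr.le, lt_inv_comm₀ (by positivity) (by positivity), inv_div] at hlarge
        exact hlarge
      rw [e]
      calc _ ≤ Λ ^ m * r ^ (σ * m) := by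
            gcongr
            exact hshift _ (by rw [abs_sub_comm])
        _ < Λ ^ m * (2 / t) := by gcongr
        _ = _ := by ring
    rw [one_div, Real.lt_rpow_inv_iff_of_pos hr.le (by positivity) (by linarith)]
    exact h3

theorem LogHolderOnWith.exists_setLIntegral_large_kernel_le (hn : 2 ≤ n) {β L sPlus : ℝ}
    (hβ : 0 < β) (hsP : sPlus < (n : ℝ) / ((n : ℝ) - 1)) :
    ∃ C : ℝ≥0, ∀ (D : Set (EuclideanSpace ℝ (Fin n))) (s : EuclideanSpace ℝ (Fin n) → ℝ),
      MeasurableSet D → LogHolderOnWith L s D → (∀ x ∈ D, ∀ y ∈ D, dist x y ≤ 2 * β) →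
      (∀ x ∈ D, 1 ≤ s x) → (∀ x ∈ D, s x ≤ sPlus) → ∀ y ∈ D, ∀ t : ℝ, 1 ≤ t →
      ∫⁻ x in D, ({x | t / 2 < dist x y ^ (-(s x * (n - 1 : ℕ)))}).indicator (fun x =>
          ENNReal.ofReal (dist x y ^ (-(s x * (n - 1 : ℕ))))
            * ENNReal.ofReal (t ^ ((n : ℝ) / (s x * (n - 1 : ℕ))))) x
        ≤ C * ENNReal.ofReal t := by
  obtain ⟨m, hm, rfl⟩ : ∃ m, 1 ≤ m ∧ n = m + 1 := ⟨n - 1, by omega, by omega⟩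
  simp only [Nat.add_sub_cancel, Nat.cast_add, Nat.cast_one, add_sub_cancel_right] at hsP ⊢
  have hmR : (1 : ℝ) ≤ m := by exact_mod_cast hm
  have hη : 0 < (m : ℝ) + 1 - sPlus * m := by
    rw [lt_div_iff₀ (by linarith)] at hsP
    linarith
  have hsP2 : sPlus < 2 := by
    refine hsP.trans_le ?_
    rw [div_le_iff₀ (by linarith)]
    linarith
  set η := (m : ℝ) + 1 - sPlus * m with hηdef
  set Λ := (1 + 2 * β) * Real.exp L with hΛdef
  set w := volume.real (Metric.ball (0 : EuclideanSpace ℝ (Fin (m + 1))) 1) with hw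
  have hw0 : 0 < w := volume_real_unitBall_pos
  refine ⟨(Λ ^ m * (2 * Λ) ^ (m + 1) * (((m : ℝ) + 1) * w * ((2 * Λ ^ m) ^ (m + 1) / η))).toNNReal,
    fun D s hD hs hdiam hs1 hsle y hy t ht => ?_⟩
  have hΛ : 1 ≤ Λ := one_le_mul_of_one_le_of_one_le (by linarith) (Real.one_le_exp hs.1.le)
  have ht0 : 0 < t := by linarith
  set σ' := s y with hσ'
  have hσ'1 : 1 ≤ σ' := hs1 y hy
  have ha' : 1 ≤ σ' * m := one_le_mul_of_one_le_of_one_le hσ'1 hmR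
  have han : σ' * m ≤ sPlus * m := by
    have := hsle y hy
    gcongr
  set q' := ((m : ℝ) + 1) / (σ' * m) with hq'
  have hq'1 : 1 ≤ q' := by
    rw [hq', le_div_iff₀ (by linarith)]
    linarith
  have hq'm : q' ≤ m + 1 := div_le_self (by positivity) ha'
  set R := (2 * Λ ^ m / t) ^ (1 / (σ' * m)) with hRdef
  have hR0 : 0 < R := by positivity
  set c := Λ ^ m * (2 * Λ) ^ (m + 1) * t ^ q' with hc
  have hc0 : 0 ≤ c := by positivity
  calc ∫⁻ x in D, ({x | t / 2 < dist x y ^ (-(s x * m))}).indicator (fun x =>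
          ENNReal.ofReal (dist x y ^ (-(s x * m))) *
            ENNReal.ofReal (t ^ (((m : ℝ) + 1) / (s x * m)))) x
      ≤ ∫⁻ x in D, (Metric.ball y R).indicator
          (fun x => ENNReal.ofReal c * ENNReal.ofReal (dist x y ^ (-(σ' * m)))) x := by
        refine setLIntegral_mono' hD fun x hx => ?_
        by_cases hlarge : t / 2 < dist x y ^ (-(s x * m))
        · rw [indicator_of_mem (by exact hlarge)]
          have hs1x := hs1 x hx
          have hxy : x ≠ y := by
            rintro rfl
            have : -(s x * (m : ℝ)) ≠ 0 := by
              have : 0 < s x * (m : ℝ) := by positivity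
              linarith
            rw [dist_self, Real.zero_rpow this] at hlarge
            linarith
          have hfr : |s x - σ'| ≤ 1 := by
            rw [abs_le]
            constructor <;> linarith [hsle x hx, hsle y hy]
          obtain ⟨h1, h2⟩ := rpow_neg_mul_rpow_le_of_lt hm (dist_pos.2 hxy) ht hs1x hσ'1 hΛ
            (fun κ hκ => hs.rpow_dist_le hx hy hxy (by linarith)
              ((hdiam x hx y hy).trans (by linarith)) hfr hκ) hlarge
          rw [indicator_of_mem (by exact h2), ← ENNReal.ofReal_mul (by positivity),
            ← ENNReal.ofReal_mul hc0]
          exact ENNReal.ofReal_le_ofReal h1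
        · rw [indicator_of_notMem (by exact hlarge)]
          exact zero_le
    _ ≤ ∫⁻ x, (Metric.ball y R).indicator
          (fun x => ENNReal.ofReal c * ENNReal.ofReal (dist x y ^ (-(σ' * m)))) x :=
        setLIntegral_le_lintegral _ _
    _ = ENNReal.ofReal c * ENNReal.ofReal (((m : ℝ) + 1) * w *
          (R ^ ((m : ℝ) + 1 - σ' * m) / ((m : ℝ) + 1 - σ' * m))) := by
        rw [lintegral_indicator Metric.isOpen_ball.measurableSet,
          lintegral_const_mul' _ _ ENNReal.ofReal_ne_top,
          setLIntegral_ball_rpow_neg_dist (by omega) (by push_cast; linarith) hR0]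
        push_cast
        rfl
    _ ≤ ENNReal.ofReal c * ENNReal.ofReal (((m : ℝ) + 1) * w *
          ((2 * Λ ^ m) ^ (m + 1) * t ^ (1 - q') / η)) := by
        have hRle : R ^ ((m : ℝ) + 1 - σ' * m) ≤ (2 * Λ ^ m) ^ (m + 1) * t ^ (1 - q') := by
          have e : 1 / (σ' * m) * ((m : ℝ) + 1 - σ' * m) = q' - 1 := by
            rw [hq']
            field_simp
          have hΛm : 1 ≤ 2 * Λ ^ m := by linarith [one_le_pow₀ hΛ (n := m)]
          rw [hRdef, ← Real.rpow_mul (by positivity), e, Real.div_rpow (by positivity) ht0.le,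
            div_eq_mul_inv, ← Real.rpow_neg ht0.le, neg_sub]
          gcongr
          calc (2 * Λ ^ m) ^ (q' - 1) ≤ (2 * Λ ^ m) ^ (((m + 1 : ℕ) : ℝ)) := by
                refine Real.rpow_le_rpow_of_exponent_le hΛm ?_
                push_cast
                linarith
            _ = (2 * Λ ^ m) ^ (m + 1) := Real.rpow_natCast _ _
        gcongr
        linarith
    _ = _ := by
        rw [← ENNReal.ofReal_mul hc0, ← ENNReal.ofNNReal_toNNReal, ← ENNReal.ofNNReal_toNNReal,
          ← ENNReal.coe_mul, ← Real.toNNReal_mul (by positivity)]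
        congr 2
        rw [hc]
        have e : t ^ q' * t ^ (1 - q') = t := by
          rw [← Real.rpow_add ht0, add_sub_cancel, Real.rpow_one]
        linear_combination Λ ^ m * (2 * Λ) ^ (m + 1) * (((m : ℝ) + 1) * w *
          ((2 * Λ ^ m) ^ (m + 1) / η)) * e

theorem LogHolderOnWith.continuousOn {D : Set (EuclideanSpace ℝ (Fin n))}
    {s : EuclideanSpace ℝ (Fin n) → ℝ} {L : ℝ} (hs : LogHolderOnWith L s D) :
    ContinuousOn s D := by
  rw [Metric.continuousOn_iff]
  intro x hx ε hε
  have hL := hs.1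
  refine ⟨Real.exp (-(L / ε)), Real.exp_pos _, fun y hy hyx => ?_⟩
  rcases eq_or_ne y x with rfl | hne
  · rwa [dist_self]
  have hr : 0 < dist y x := dist_pos.2 hne
  have h1 : L / ε < Real.log (Real.exp 1 + 1 / dist y x) := by
    have h2 : L / ε < Real.log (1 / dist y x) := by
      rw [one_div, Real.log_inv, lt_neg, Real.log_lt_iff_lt_exp hr]
      exact hyx
    exact h2.trans_le (Real.log_le_log (by positivity) (by linarith [Real.exp_pos 1]))
  have hpos : 0 < Real.log (Real.exp 1 + 1 / dist y x) := lt_trans (by positivity) h1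
  rw [Real.dist_eq]
  refine (hs.2 y hy x hx hne).trans_lt ?_
  rw [div_lt_iff₀ hε] at h1
  rw [div_lt_iff₀ hpos]
  linarith

theorem mul_lintegral_le_of_schur {X Y : Type*} [MeasurableSpace X] [MeasurableSpace Y]
    {ν : Measure X} {μ : Measure Y} [SFinite ν] [SFinite μ] {g : Y → ℝ≥0∞} {K : X → Y → ℝ≥0∞}
    {W : X → ℝ≥0∞} (hg : Measurable g) (hK : Measurable (Function.uncurry K)) (hW : Measurable W)
    {a b : ℝ≥0∞} (ha : ∀ᵐ x ∂ν, a ≤ ∫⁻ y, g y * K x y ∂μ)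
    (hb : ∀ᵐ y ∂μ, ∫⁻ x, K x y * W x ∂ν ≤ b) :
    a * ∫⁻ x, W x ∂ν ≤ (∫⁻ y, g y ∂μ) * b := by
  have hK₁ : ∀ x, Measurable (K x) := fun x => hK.comp measurable_prodMk_left
  have hK₂ : ∀ y, Measurable fun x => K x y := fun y => hK.comp measurable_prodMk_right
  calc a * ∫⁻ x, W x ∂ν = ∫⁻ x, a * W x ∂ν := (lintegral_const_mul _ hW).symm
    _ ≤ ∫⁻ x, (∫⁻ y, g y * K x y ∂μ) * W x ∂ν := by
        refine lintegral_mono_ae ?_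
        filter_upwards [ha] with x hx
        gcongr
    _ = ∫⁻ x, ∫⁻ y, g y * K x y * W x ∂μ ∂ν :=
        lintegral_congr fun x => (lintegral_mul_const _ (hg.mul (hK₁ x))).symm
    _ = ∫⁻ y, ∫⁻ x, g y * K x y * W x ∂ν ∂μ := by
        refine lintegral_lintegral_swap (Measurable.aemeasurable ?_)
        exact ((hg.comp measurable_snd).mul hK).mul (hW.comp measurable_fst)
    _ = ∫⁻ y, g y * ∫⁻ x, K x y * W x ∂ν ∂μ := by
        refine lintegral_congr fun y => ?_
        simp_rw [mul_assoc]
        exact lintegral_const_mul _ ((hK₂ y).mul hW)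
    _ ≤ ∫⁻ y, g y * b ∂μ := by
        refine lintegral_mono_ae ?_
        filter_upwards [hb] with y hy
        gcongr
    _ = (∫⁻ y, g y ∂μ) * b := lintegral_mul_const _ hg

theorem LogHolderOnWith.exists_weakType (hn : 2 ≤ n) {β L sPlus : ℝ}
    (hβ : 0 < β) (hsP : sPlus < (n : ℝ) / ((n : ℝ) - 1)) :
    ∃ C : ℝ≥0, ∀ (D : Set (EuclideanSpace ℝ (Fin n))) (s : EuclideanSpace ℝ (Fin n) → ℝ),
      IsOpen D → LogHolderOnWith L s D → (∀ x ∈ D, ∀ y ∈ D, dist x y ≤ 2 * β) →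
      (∀ x ∈ D, 1 ≤ s x) → (∀ x ∈ D, s x ≤ sPlus) →
      ∀ g : EuclideanSpace ℝ (Fin n) → ℝ≥0∞, AEMeasurable g (volume.restrict D) →
      ∫⁻ y in D, g y ≤ 1 → ∀ t : ℝ, 1 ≤ t →
      ∫⁻ x in {x ∈ D | ENNReal.ofReal t <
          ∫⁻ y in D, g y * ENNReal.ofReal (dist x y ^ (-(s x * (n - 1 : ℕ))))},
          ENNReal.ofReal (t ^ ((n : ℝ) / (s x * (n - 1 : ℕ))))
        ≤ C * ∫⁻ y in D, g y := by
  obtain ⟨C, hC⟩ := exists_setLIntegral_large_kernel_le (L := L) hn hβ hsP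
  refine ⟨2 * C, fun D s hD hs hdiam hs1 hsle g hg hg1 t ht => ?_⟩
  have ht0 : 0 < t := by linarith
  have hDm := hD.measurableSet
  set s' := D.indicator s with hs'
  have hs'm : Measurable s' := by
    classical
    rw [hs', ← piecewise_eq_indicator]
    exact hs.continuousOn.measurable_piecewise continuousOn_const hDm
  set g' := hg.mk g with hg'
  have hg'm : Measurable g' := hg.measurable_mk
  have hgg : g =ᵐ[volume.restrict D] g' := hg.ae_eq_mk
  set K : EuclideanSpace ℝ (Fin n) → EuclideanSpace ℝ (Fin n) → ℝ≥0∞ := fun x y =>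
    ENNReal.ofReal (dist x y ^ (-(s' x * (n - 1 : ℕ)))) with hK
  have hKm : Measurable (Function.uncurry K) := by
    simp only [hK, Function.uncurry_def]
    fun_prop
  set W : EuclideanSpace ℝ (Fin n) → ℝ≥0∞ := fun x =>
    ENNReal.ofReal (t ^ ((n : ℝ) / (s' x * (n - 1 : ℕ)))) with hW
  have hWm : Measurable W := by
    simp only [hW]
    fun_prop
  set P : EuclideanSpace ℝ (Fin n) → ℝ≥0∞ := fun x => ∫⁻ y in D, g' y * K x y with hP
  have hPm : Measurable P := by
    refine Measurable.lintegral_prod_right'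
      (f := fun p : EuclideanSpace ℝ (Fin n) × EuclideanSpace ℝ (Fin n) => g' p.2 * K p.1 p.2) ?_
    exact (hg'm.comp measurable_snd).mul hKm
  set F : Set (EuclideanSpace ℝ (Fin n)) := {x ∈ D | ENNReal.ofReal t < P x} with hF
  have hFm : MeasurableSet F := hDm.inter (measurableSet_lt measurable_const hPm)
  have hFD : F ⊆ D := fun x hx => hx.1
  have hset : {x ∈ D | ENNReal.ofReal t <
      ∫⁻ y in D, g y * ENNReal.ofReal (dist x y ^ (-(s x * (n - 1 : ℕ))))} = F := by
    ext x
    refine and_congr_right fun hx => ?_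
    have : ∫⁻ y in D, g y * ENNReal.ofReal (dist x y ^ (-(s x * (n - 1 : ℕ)))) = P x := by
      refine lintegral_congr_ae ?_
      filter_upwards [hgg] with y hy
      simp only [hK, hs', indicator_of_mem hx, hy]
    rw [this]
  have hGg : ∫⁻ y in D, g y = ∫⁻ y in D, g' y := lintegral_congr_ae hgg
  rw [hset, hGg]
  rw [hGg] at hg1
  set N := ∫⁻ y in D, g' y with hN
  have hFW : ∫⁻ x in F, ENNReal.ofReal (t ^ ((n : ℝ) / (s x * (n - 1 : ℕ)))) = ∫⁻ x in F, W x :=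
    setLIntegral_congr_fun hFm fun x hx => by simp only [hW, hs', indicator_of_mem (hFD hx)]
  rw [hFW]
  set m := ∫⁻ x in F, W x with hm
  have hmfin : m ≠ ⊤ := by
    have hvol : volume D ≠ ⊤ := by
      rcases D.eq_empty_or_nonempty with h | ⟨z, hz⟩
      · simp [h]
      · refine ((measure_mono fun x hx => ?_).trans_lt
          (measure_closedBall_lt_top (μ := volume) (x := z) (r := 2 * β))).ne
        exact hdiam x hx z hz
    have hb : m ≤ ENNReal.ofReal (t ^ (n : ℝ)) * volume D := by
      calc m ≤ ∫⁻ x in F, ENNReal.ofReal (t ^ (n : ℝ)) := by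
            refine setLIntegral_mono' hFm fun x hx => ENNReal.ofReal_le_ofReal ?_
            refine Real.rpow_le_rpow_of_exponent_le ht (div_le_self (by positivity) ?_)
            rw [hs', indicator_of_mem (hFD hx)]
            refine one_le_mul_of_one_le_of_one_le (hs1 x (hFD hx)) ?_
            exact_mod_cast (by omega : 1 ≤ n - 1)
        _ ≤ ENNReal.ofReal (t ^ (n : ℝ)) * volume D := by
            rw [setLIntegral_const]
            gcongr
    exact (hb.trans_lt (ENNReal.mul_lt_top ENNReal.ofReal_lt_top hvol.lt_top)).ne
  have hinner : ∀ y ∈ D, ∫⁻ x in F, K x y * W x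
      ≤ ENNReal.ofReal (t / 2) * m + C * ENNReal.ofReal t := by
    intro y hy
    set Q : Set (EuclideanSpace ℝ (Fin n)) :=
      {x | t / 2 < dist x y ^ (-(s x * (n - 1 : ℕ)))} with hQ
    calc ∫⁻ x in F, K x y * W x
        ≤ ∫⁻ x in F, (ENNReal.ofReal (t / 2) * W x + Q.indicator (fun x =>
          ENNReal.ofReal (dist x y ^ (-(s x * (n - 1 : ℕ))))
            * ENNReal.ofReal (t ^ ((n : ℝ) / (s x * (n - 1 : ℕ))))) x) := by
          refine setLIntegral_mono' hFm fun x hx => ?_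
          have hKx : K x y = ENNReal.ofReal (dist x y ^ (-(s x * (n - 1 : ℕ)))) := by
            simp only [hK, hs', indicator_of_mem (hFD hx)]
          have hWx : W x = ENNReal.ofReal (t ^ ((n : ℝ) / (s x * (n - 1 : ℕ)))) := by
            simp only [hW, hs', indicator_of_mem (hFD hx)]
          by_cases hxQ : x ∈ Q
          · rw [indicator_of_mem hxQ, ← hKx, ← hWx]
            exact le_add_self
          · rw [indicator_of_notMem hxQ, add_zero, hKx]
            gcongr
            exact not_lt.1 hxQ
      _ = ENNReal.ofReal (t / 2) * m + ∫⁻ x in F, Q.indicator (fun x =>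
          ENNReal.ofReal (dist x y ^ (-(s x * (n - 1 : ℕ))))
            * ENNReal.ofReal (t ^ ((n : ℝ) / (s x * (n - 1 : ℕ))))) x := by
          rw [lintegral_add_left (hWm.const_mul _), lintegral_const_mul _ hWm]
      _ ≤ _ := by
          gcongr
          exact (lintegral_mono_set hFD).trans (hC D s hDm hs hdiam hs1 hsle y hy t ht)
  have hmain : ENNReal.ofReal t * m
      ≤ N * (ENNReal.ofReal (t / 2) * m + C * ENNReal.ofReal t) := by
    refine mul_lintegral_le_of_schur hg'm hKm hWm ?_ ?_
    · filter_upwards [ae_restrict_mem hFm] with x hx using hx.2.le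
    · filter_upwards [ae_restrict_mem hDm] with y hy using hinner y hy
  have hhalf : ENNReal.ofReal t = ENNReal.ofReal (t / 2) + ENNReal.ofReal (t / 2) := by
    rw [← ENNReal.ofReal_add (by positivity) (by positivity), add_halves]
  have h2 : ENNReal.ofReal (t / 2) * m + ENNReal.ofReal (t / 2) * m
      ≤ ENNReal.ofReal (t / 2) * m + ENNReal.ofReal (t / 2) * (2 * C * N) := by
    calc _ = ENNReal.ofReal t * m := by rw [hhalf, add_mul]
      _ ≤ N * (ENNReal.ofReal (t / 2) * m + C * ENNReal.ofReal t) := hmain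
      _ = N * (ENNReal.ofReal (t / 2) * m) + ENNReal.ofReal (t / 2) * (2 * C * N) := by
          rw [hhalf]; ring
      _ ≤ 1 * (ENNReal.ofReal (t / 2) * m) + ENNReal.ofReal (t / 2) * (2 * C * N) := by gcongr
      _ = _ := by rw [one_mul]
  have h3 := (ENNReal.add_le_add_iff_left (ENNReal.mul_ne_top ENNReal.ofReal_ne_top hmfin)).1 h2
  have h4 := (ENNReal.mul_le_mul_iff_right
    (ENNReal.ofReal_pos.2 (by positivity : 0 < t / 2)).ne' ENNReal.ofReal_ne_top).1 h3
  simpa using h4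

end WeakType

/-! ### Smooth truncation -/

section Truncation

/-- A smooth even function that vanishes on `[-1, 1]` and is `1` outside `(-2, 2)`. -/
noncomputable def smoothTruncation (t : ℝ) : ℝ :=
  Real.smoothTransition (t - 1) + Real.smoothTransition (-t - 1)

theorem contDiff_smoothTruncation : ContDiff ℝ 1 smoothTruncation := by
  unfold smoothTruncation
  exact (Real.smoothTransition.contDiff.comp (by fun_prop)).add
    (Real.smoothTransition.contDiff.comp (by fun_prop))

theorem smoothTruncation_nonneg (t : ℝ) : 0 ≤ smoothTruncation t :=
  add_nonneg (Real.smoothTransition.nonneg _) (Real.smoothTransition.nonneg _)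

theorem smoothTruncation_le_one (t : ℝ) : smoothTruncation t ≤ 1 := by
  unfold smoothTruncation
  rcases le_total t 0 with h | h
  · rw [Real.smoothTransition.zero_of_nonpos (by linarith), zero_add]
    exact Real.smoothTransition.le_one _
  · rw [Real.smoothTransition.zero_of_nonpos (x := -t - 1) (by linarith), add_zero]
    exact Real.smoothTransition.le_one _

theorem smoothTruncation_eq_zero {t : ℝ} (ht : |t| ≤ 1) : smoothTruncation t = 0 := by
  unfold smoothTruncation
  rw [abs_le] at ht
  rw [Real.smoothTransition.zero_of_nonpos (by linarith),
    Real.smoothTransition.zero_of_nonpos (by linarith), zero_add]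

theorem smoothTruncation_eq_one {t : ℝ} (ht : 2 ≤ |t|) : smoothTruncation t = 1 := by
  unfold smoothTruncation
  rcases le_abs.1 ht with h | h
  · rw [Real.smoothTransition.one_of_one_le (by linarith),
      Real.smoothTransition.zero_of_nonpos (by linarith), add_zero]
  · rw [Real.smoothTransition.zero_of_nonpos (by linarith),
      Real.smoothTransition.one_of_one_le (by linarith), zero_add]

theorem deriv_smoothTruncation_eq_zero {t : ℝ} (ht : ¬(1 < |t| ∧ |t| < 2)) :
    deriv smoothTruncation t = 0 := by
  rcases le_or_gt |t| 1 with h | h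
  · refine IsLocalMin.deriv_eq_zero (Filter.Eventually.of_forall fun x => ?_)
    rw [smoothTruncation_eq_zero h]
    exact smoothTruncation_nonneg x
  · refine IsLocalMax.deriv_eq_zero (Filter.Eventually.of_forall fun x => ?_)
    rw [smoothTruncation_eq_one (not_lt.1 fun h2 => ht ⟨h, h2⟩)]
    exact smoothTruncation_le_one x

theorem exists_abs_deriv_smoothTruncation_le :
    ∃ M : ℝ, 0 < M ∧ ∀ t, |deriv smoothTruncation t| ≤ M := by
  have hc : Continuous (deriv smoothTruncation) :=
    contDiff_smoothTruncation.continuous_deriv le_rfl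
  obtain ⟨M, hM⟩ := (isCompact_Icc (a := (-2 : ℝ)) (b := 2)).exists_bound_of_continuousOn
    hc.continuousOn
  refine ⟨|M| + 1, by positivity, fun t => ?_⟩
  by_cases ht : 1 < |t| ∧ |t| < 2
  · have := hM t (abs_le.1 ht.2.le)
    rw [Real.norm_eq_abs] at this
    linarith [le_abs_self M]
  · rw [deriv_smoothTruncation_eq_zero ht, abs_zero]
    positivity

end Truncation

/-! ### Integrability on the central ball -/

section CentralBall

variable {n : ℕ}

theorem HasWeakGradientOn.hasBallPoincare_comp {D : Set (EuclideanSpace ℝ (Fin n))}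
    {u : EuclideanSpace ℝ (Fin n) → ℝ} {G : EuclideanSpace ℝ (Fin n) → EuclideanSpace ℝ (Fin n)}
    (h : HasWeakGradientOn u G D) (hD : IsOpen D) {Φ : ℝ → ℝ} (hΦ : ContDiff ℝ 1 Φ) {M : ℝ≥0}
    (hM : ∀ t, ‖deriv Φ t‖ₑ ≤ M) {g : EuclideanSpace ℝ (Fin n) → ℝ≥0∞}
    (hg : ∀ y, ‖deriv Φ (u y)‖ₑ * ‖G y‖ₑ ≤ g y) :
    HasBallPoincare (fun x => Φ (u x)) g D := by
  intro z r hr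
  refine (h.lintegral_lintegral_enorm_comp_sub_le hD hr hΦ hM).trans ?_
  gcongr
  exact hg _

/-- The Poincaré inequality on a ball contained in `D` whose boundary may touch the boundary
of `D`. -/
theorem HasBallPoincare.lintegral_lintegral_le_of_ball_subset
    {D : Set (EuclideanSpace ℝ (Fin n))}
    {u : EuclideanSpace ℝ (Fin n) → ℝ} {g : EuclideanSpace ℝ (Fin n) → ℝ≥0∞}
    (h : HasBallPoincare u g D) (hu : AEMeasurable u (volume.restrict D))
    {z : EuclideanSpace ℝ (Fin n)} {δ : ℝ} (hδ : 0 < δ) (hz : Metric.ball z δ ⊆ D) :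
    ∫⁻ x in Metric.ball z δ, ∫⁻ y in Metric.ball z δ, ‖u x - u y‖ₑ
      ≤ 2 ^ (n + 1) * ENNReal.ofReal δ * volume (Metric.ball z δ)
        * ∫⁻ y in Metric.ball z δ, g y := by
  set r : ℕ → ℝ := fun k => δ - δ / (k + 1) with hr
  have hrlt : ∀ k, r k < δ := fun k => by
    have : 0 < δ / ((k : ℝ) + 1) := by positivity
    simp only [hr]
    linarith
  have hmono : Monotone r := fun j k hjk => by
    simp only [hr]
    gcongr
  set S : ℕ → Set (EuclideanSpace ℝ (Fin n) × EuclideanSpace ℝ (Fin n)) := fun k =>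
    Metric.ball z (r k) ×ˢ Metric.ball z (r k) with hS
  have hSmono : Monotone S := fun j k hjk =>
    prod_mono (Metric.ball_subset_ball (hmono hjk)) (Metric.ball_subset_ball (hmono hjk))
  have hU : Metric.ball z δ ×ˢ Metric.ball z δ = ⋃ k, S k := by
    refine Subset.antisymm (fun p hp => ?_) (iUnion_subset fun k => ?_)
    · have hlim : Filter.Tendsto r Filter.atTop (nhds δ) := by
        have := ((tendsto_one_div_add_atTop_nhds_zero_nat (𝕜 := ℝ)).const_mul δ).const_sub δ
        simpa [hr, div_eq_mul_inv] using this
      have h1 := hlim.eventually_const_lt (show dist p.1 z < δ from hp.1)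
      have h2 := hlim.eventually_const_lt (show dist p.2 z < δ from hp.2)
      obtain ⟨k, hk1, hk2⟩ := (h1.and h2).exists
      exact mem_iUnion.2 ⟨k, hk1, hk2⟩
    · exact prod_mono (Metric.ball_subset_ball (hrlt k).le) (Metric.ball_subset_ball (hrlt k).le)
  have hm : ∀ B : Set (EuclideanSpace ℝ (Fin n)), B ⊆ D →
      AEMeasurable (fun p : EuclideanSpace ℝ (Fin n) × EuclideanSpace ℝ (Fin n) =>
        ‖u p.1 - u p.2‖ₑ) ((volume.prod volume).restrict (B ×ˢ B)) := by
    intro B hB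
    rw [← Measure.prod_restrict]
    have hu' := hu.mono_measure (Measure.restrict_mono hB le_rfl)
    exact (hu'.comp_fst.sub hu'.comp_snd).enorm
  have hball : ∀ k, Metric.ball z (r k) ⊆ D := fun k =>
    (Metric.ball_subset_ball (hrlt k).le).trans hz
  rw [← setLIntegral_prod _ (hm _ hz), hU, setLIntegral_iUnion_of_directed _ hSmono.directed_le]
  refine iSup_le fun k => ?_
  rw [setLIntegral_prod _ (hm _ (hball k))]
  refine (h z (r k) ((Metric.closedBall_subset_ball (hrlt k)).trans hz)).trans ?_
  have hsub : Metric.ball z (r k) ⊆ Metric.ball z δ := Metric.ball_subset_ball (hrlt k).le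
  gcongr
  exact (hrlt k).le

theorem HasWeakGradientOn.aemeasurable {D : Set (EuclideanSpace ℝ (Fin n))}
    {u : EuclideanSpace ℝ (Fin n) → ℝ} {G : EuclideanSpace ℝ (Fin n) → EuclideanSpace ℝ (Fin n)}
    (h : HasWeakGradientOn u G D) : AEMeasurable u (volume.restrict D) :=
  h.locallyIntegrableOn.aestronglyMeasurable.aemeasurable

theorem HasWeakGradientOn.integrableOn_ball {D : Set (EuclideanSpace ℝ (Fin n))}
    {u : EuclideanSpace ℝ (Fin n) → ℝ} {G : EuclideanSpace ℝ (Fin n) → EuclideanSpace ℝ (Fin n)}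
    (h : HasWeakGradientOn u G D) (hD : IsOpen D) (hG : ∫⁻ x in D, ‖G x‖ₑ ≠ ⊤)
    {z : EuclideanSpace ℝ (Fin n)} {δ : ℝ} (hδ : 0 < δ) (hz : Metric.ball z δ ⊆ D) :
    IntegrableOn u (Metric.ball z δ) ∧
      ∫⁻ x in Metric.ball z δ, ‖u x - ⨍ y in Metric.ball z δ, u y‖ₑ
        ≤ 2 ^ (n + 1) * ENNReal.ofReal δ * ∫⁻ x in D, ‖G x‖ₑ := by
  have hP : HasBallPoincare u (fun y => ‖G y‖ₑ) D :=
    h.hasBallPoincare_comp hD (Φ := id) contDiff_id (M := 1) (by simp) (by simp)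
  have hv0 : volume (Metric.ball z δ) ≠ 0 := (Metric.measure_ball_pos _ _ hδ).ne'
  have hvt : volume (Metric.ball z δ) ≠ ⊤ := measure_ball_lt_top.ne
  have hmain := (hP.lintegral_lintegral_le_of_ball_subset h.aemeasurable hδ hz).trans
    (mul_le_mul_right (lintegral_mono_set (f := fun y => ‖G y‖ₑ) hz) _)
  have hfin : ∫⁻ x in Metric.ball z δ, ∫⁻ y in Metric.ball z δ, ‖u x - u y‖ₑ ≠ ⊤ :=
    (hmain.trans_lt (by finiteness)).ne
  have hInt : IntegrableOn u (Metric.ball z δ) := by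
    obtain ⟨x, -, hx⟩ : ∃ x ∈ Metric.ball z δ,
        ∫⁻ y in Metric.ball z δ, ‖u x - u y‖ₑ ≠ ⊤ := by
      by_contra! hcon
      refine hfin ?_
      rw [setLIntegral_congr_fun (g := fun _ => ⊤) Metric.isOpen_ball.measurableSet hcon,
        setLIntegral_const, ENNReal.top_mul hv0]
    have hum := h.aemeasurable.mono_measure (Measure.restrict_mono hz le_rfl)
    have h1 : IntegrableOn (fun y => u x - u y) (Metric.ball z δ) :=
      ⟨(aemeasurable_const.sub hum).aestronglyMeasurable, hx.lt_top⟩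
    have h2 : IntegrableOn (fun y => u x - (u x - u y)) (Metric.ball z δ) :=
      Integrable.sub (integrableOn_const hvt) h1
    simpa using h2
  refine ⟨hInt, ?_⟩
  calc ∫⁻ x in Metric.ball z δ, ‖u x - ⨍ y in Metric.ball z δ, u y‖ₑ
      ≤ ∫⁻ x in Metric.ball z δ, (volume (Metric.ball z δ))⁻¹ *
          ∫⁻ y in Metric.ball z δ, ‖u x - u y‖ₑ := by
        refine lintegral_mono fun x => ?_
        rw [enorm_sub_rev]
        refine (enorm_setAverage_sub_le hv0 hvt hInt _).trans_eq ?_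
        simp_rw [enorm_sub_rev (u x)]
    _ = (volume (Metric.ball z δ))⁻¹ *
          ∫⁻ x in Metric.ball z δ, ∫⁻ y in Metric.ball z δ, ‖u x - u y‖ₑ :=
        lintegral_const_mul' _ _ (ENNReal.inv_ne_top.2 hv0)
    _ ≤ (volume (Metric.ball z δ))⁻¹ * (2 ^ (n + 1) * ENNReal.ofReal δ *
          volume (Metric.ball z δ) * ∫⁻ x in D, ‖G x‖ₑ) := by gcongr
    _ = (volume (Metric.ball z δ))⁻¹ * volume (Metric.ball z δ) *
          (2 ^ (n + 1) * ENNReal.ofReal δ * ∫⁻ x in D, ‖G x‖ₑ) := by ring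
    _ = _ := by rw [ENNReal.inv_mul_cancel hv0 hvt, one_mul]

end CentralBall

/-! ### The Sobolev–Poincaré inequality -/

section SobolevPoincare

variable {n : ℕ}

theorem IsJohnDomain.exists_level_estimate (hn : 2 ≤ n) {α β sPlus δ L : ℝ} (hα : 0 < α)
    (hαβ : α ≤ β) (hδ : 0 < δ) (hsP : sPlus < (n : ℝ) / ((n : ℝ) - 1)) :
    ∃ (C : ℝ≥0) (l₀ : ℝ), 0 < l₀ ∧
      ∀ (D : Set (EuclideanSpace ℝ (Fin n))) (s : EuclideanSpace ℝ (Fin n) → ℝ)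
        (x₀ : EuclideanSpace ℝ (Fin n)), IsJohnDomain D s α β x₀ →
        Metric.infDist x₀ (frontier D) = δ → LogHolderOnWith L s D →
        (∀ x ∈ D, s x ≤ sPlus) →
        ∀ (u : EuclideanSpace ℝ (Fin n) → ℝ)
          (G : EuclideanSpace ℝ (Fin n) → EuclideanSpace ℝ (Fin n)),
          HasWeakGradientOn u G D → ∀ N : ℝ, 0 < N → ∫⁻ x in D, ‖G x‖ₑ ≤ ENNReal.ofReal N →
          ∀ l : ℝ, l₀ ≤ l →
          ∫⁻ x in D, ({x | 2 * l ≤ |u x - ⨍ y in Metric.ball x₀ δ, u y| / N}).indicator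
              (fun x => ENNReal.ofReal (l ^ ((n : ℝ) / (s x * (n - 1 : ℕ))))) x
            ≤ C * ∫⁻ x in D, ({x | l < |u x - ⨍ y in Metric.ball x₀ δ, u y| / N ∧
                |u x - ⨍ y in Metric.ball x₀ δ, u y| / N < 2 * l}).indicator
              (fun x => ‖G x‖ₑ / ENNReal.ofReal N) x := by
  have hβ : 0 < β := hα.trans_le hαβ
  have hnR : (2 : ℝ) ≤ n := by exact_mod_cast hn
  obtain ⟨M, hM0, hM⟩ := exists_abs_deriv_smoothTruncation_le
  obtain ⟨C, hC⟩ := LogHolderOnWith.exists_weakType (L := L) hn hβ hsP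
  have hsP2 : sPlus ≤ 2 := by
    refine hsP.le.trans ?_
    rw [div_le_iff₀ (by linarith)]
    linarith
  set A : ℝ := averageConst n * ((2 + 43 ^ n) * (4 * (2 * (β / α) + (1 + 2 * β))) ^ (n - 1))
    with hA
  have hA0 : 0 < A := by
    have := averageConst_pos (n := n)
    positivity
  set w := volume.real (Metric.ball (0 : EuclideanSpace ℝ (Fin n)) 1) with hw
  have hw0 : 0 < w := volume_real_unitBall_pos
  set C₁ : ℝ := 2 ^ (n + 1) * δ / ((δ / 4) ^ n * w) with hC₁
  have hC₁0 : 0 < C₁ := by positivity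
  set Θ : ℝ := max 1 (4 * (A * M)) with hΘ
  have hΘ1 : 1 ≤ Θ := le_max_left _ _
  refine ⟨(Θ ^ n).toNNReal * C, max Θ (2 * C₁), lt_max_of_lt_left (by linarith), ?_⟩
  intro D s x₀ hJ hδD hs hsle u G hu N hN hGN l hl
  have hD := hJ.isOpen
  have hDm := hD.measurableSet
  have hl0 : 0 < l := lt_of_lt_of_le (by linarith) ((le_max_left _ _).trans hl)
  set c := ⨍ y in Metric.ball x₀ δ, u y with hc
  have hballD : Metric.ball x₀ δ ⊆ D := by
    rw [← hδD]
    exact hD.ball_infDist_frontier_subset hJ.center_mem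
  obtain ⟨hui, huB⟩ := hu.integrableOn_ball hD (hGN.trans_lt ENNReal.ofReal_lt_top).ne hδ hballD
  -- the truncated function
  set Φ : ℝ → ℝ := fun τ => l * smoothTruncation ((τ - c) / N / l) with hΦ
  have hΦc : ContDiff ℝ 1 Φ :=
    contDiff_const.mul (contDiff_smoothTruncation.comp (by fun_prop))
  have hΦd : ∀ τ, deriv Φ τ = deriv smoothTruncation ((τ - c) / N / l) / N := by
    intro τ
    have h1 := ((contDiff_smoothTruncation.differentiable one_ne_zero
      ((τ - c) / N / l)).hasDerivAt).comp τ
      ((((hasDerivAt_id τ).sub_const c).div_const N).div_const l)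
    have h2 : HasDerivAt Φ _ τ := h1.const_mul l
    rw [h2.deriv]
    field_simp
  have hscale : ∀ τ, |(τ - c) / N / l| = |τ - c| / N / l := fun τ => by
    rw [abs_div, abs_div, abs_of_pos hN, abs_of_pos hl0]
  set T : Set (EuclideanSpace ℝ (Fin n)) := {x | l < |u x - c| / N ∧ |u x - c| / N < 2 * l}
    with hT
  set g : EuclideanSpace ℝ (Fin n) → ℝ≥0∞ := T.indicator fun x => ‖G x‖ₑ / ENNReal.ofReal N
    with hg
  have hNe : ENNReal.ofReal N ≠ 0 := (ENNReal.ofReal_pos.2 hN).ne'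
  have hum := hu.aemeasurable
  have hwm : AEMeasurable (fun x => |u x - c| / N) (volume.restrict D) := by fun_prop
  have hTm : NullMeasurableSet T (volume.restrict D) :=
    (nullMeasurableSet_lt aemeasurable_const hwm).inter
      (nullMeasurableSet_lt hwm aemeasurable_const)
  have hGm : AEMeasurable (fun x => ‖G x‖ₑ) (volume.restrict D) :=
    hu.locallyIntegrableOn_gradient.aestronglyMeasurable.enorm
  have hgm : AEMeasurable g (volume.restrict D) := (hGm.div_const _).indicator₀ hTm
  have hg1 : ∫⁻ x in D, g x ≤ 1 := by
    calc ∫⁻ x in D, g x ≤ ∫⁻ x in D, ‖G x‖ₑ / ENNReal.ofReal N :=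
          lintegral_mono fun x => indicator_le_self _ _ x
      _ = (∫⁻ x in D, ‖G x‖ₑ) / ENNReal.ofReal N := by
          simp_rw [div_eq_mul_inv]
          exact lintegral_mul_const' _ _ (ENNReal.inv_ne_top.2 hNe)
      _ ≤ 1 := ENNReal.div_le_of_le_mul (by rwa [one_mul])
  have hMe : ∀ τ, ‖deriv Φ τ‖ₑ ≤ ENNReal.ofReal M / ENNReal.ofReal N := fun τ => by
    rw [hΦd, ← ofReal_norm, Real.norm_eq_abs, abs_div, abs_of_pos hN, ENNReal.ofReal_div_of_pos hN]
    gcongr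
    exact hM _
  have hP : HasBallPoincare (fun x => Φ (u x)) (fun y => ENNReal.ofReal M * g y) D := by
    refine hu.hasBallPoincare_comp hD hΦc (M := (M / N).toNNReal) (fun τ => ?_) fun y => ?_
    · rw [ENNReal.ofNNReal_toNNReal, ENNReal.ofReal_div_of_pos hN]
      exact hMe τ
    · by_cases hy : y ∈ T
      · rw [hg, indicator_of_mem hy]
        calc _ ≤ ENNReal.ofReal M / ENNReal.ofReal N * ‖G y‖ₑ := by gcongr; exact hMe _
          _ = _ := by simp only [div_eq_mul_inv]; ring
      · have : deriv Φ (u y) = 0 := by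
          rw [hΦd, deriv_smoothTruncation_eq_zero, zero_div]
          rw [hscale, lt_div_iff₀ hl0, one_mul, div_lt_iff₀ hl0]
          exact hy
        rw [this, enorm_zero, zero_mul]
        exact zero_le
  have hΦ0 : ∀ τ, 0 ≤ Φ τ := fun τ => mul_nonneg hl0.le (smoothTruncation_nonneg _)
  have hΦl : ∀ τ, Φ τ ≤ l := fun τ => mul_le_of_le_one_right hl0.le (smoothTruncation_le_one _)
  have hDfin : volume D ≠ ⊤ := hJ.isBounded.measure_lt_top.ne
  have hvi : IntegrableOn (fun x => Φ (u x)) D := by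
    refine IntegrableOn.of_bound hDfin.lt_top
      (hΦc.continuous.measurable.comp_aemeasurable hum).aestronglyMeasurable l
      (ae_of_all _ fun x => ?_)
    rw [Real.norm_eq_abs, abs_of_nonneg (hΦ0 _)]
    exact hΦl _
  -- the average of the truncation over the small central ball
  have hsmall : Metric.ball x₀ (δ / 4) ⊆ Metric.ball x₀ δ := Metric.ball_subset_ball (by linarith)
  have havg : ⨍ y in Metric.ball x₀ (δ / 4), Φ (u y) ≤ l / 2 := by
    have hvol : volume.real (Metric.ball x₀ (δ / 4)) = (δ / 4) ^ n * w := by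
      rw [measureReal_def, volume_ball_eq_ofReal x₀ (by positivity),
        ENNReal.toReal_ofReal (by positivity)]
    have hi1 : IntegrableOn (fun y => |u y - c|) (Metric.ball x₀ δ) :=
      (hui.sub (integrableOn_const measure_ball_lt_top.ne)).abs
    have h1 : ∫ y in Metric.ball x₀ (δ / 4), |u y - c| ≤ 2 ^ (n + 1) * δ * N := by
      rw [integral_eq_lintegral_of_nonneg_ae (ae_of_all _ fun y => abs_nonneg _)
        (hi1.mono_set hsmall).aestronglyMeasurable]
      refine ENNReal.toReal_le_of_le_ofReal (by positivity) ?_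
      calc ∫⁻ y in Metric.ball x₀ (δ / 4), ENNReal.ofReal |u y - c|
          ≤ ∫⁻ y in Metric.ball x₀ δ, ‖u y - c‖ₑ := by
            simp_rw [← Real.norm_eq_abs, ofReal_norm]
            exact lintegral_mono_set hsmall
        _ ≤ 2 ^ (n + 1) * ENNReal.ofReal δ * ENNReal.ofReal N := huB.trans (by gcongr)
        _ = ENNReal.ofReal (2 ^ (n + 1) * δ * N) := by
            rw [ENNReal.ofReal_mul (by positivity), ENNReal.ofReal_mul (by positivity),
              ENNReal.ofReal_pow two_pos.le, ENNReal.ofReal_ofNat]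
    have h2 : ∫ y in Metric.ball x₀ (δ / 4), Φ (u y)
        ≤ ∫ y in Metric.ball x₀ (δ / 4), |u y - c| / N := by
      refine setIntegral_mono_on (hvi.mono_set (hsmall.trans hballD))
        ((hi1.mono_set hsmall).div_const N) Metric.isOpen_ball.measurableSet fun y _ => ?_
      rcases le_total (|u y - c| / N) l with h | h
      · have : Φ (u y) = 0 := by
          simp only [hΦ]
          rw [smoothTruncation_eq_zero, mul_zero]
          rw [hscale, div_le_one hl0]
          exact h
        rw [this]
        positivity
      · exact (hΦl _).trans h
    rw [setAverage_eq, smul_eq_mul, hvol, inv_mul_le_iff₀ (by positivity)]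
    refine h2.trans ?_
    rw [integral_div, div_le_iff₀ hN]
    refine h1.trans ?_
    have h3 : 2 * C₁ ≤ l := (le_max_right _ _).trans hl
    have h4 : 2 ^ (n + 1) * δ = C₁ * ((δ / 4) ^ n * w) := by
      rw [hC₁, div_mul_cancel₀ _ (by positivity)]
    rw [h4]
    have h5 : 0 < (δ / 4) ^ n * w * N := by positivity
    nlinarith
  -- the set where `u` is large is contained in a superlevel set of the potential
  set t : ℝ := l / Θ with ht
  have ht1 : 1 ≤ t := by
    rw [ht, le_div_iff₀ (by linarith), one_mul]
    exact (le_max_left _ _).trans hl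
  set F : Set (EuclideanSpace ℝ (Fin n)) := {x ∈ D | ENNReal.ofReal t <
    ∫⁻ y in D, g y * ENNReal.ofReal (dist x y ^ (-(s x * (n - 1 : ℕ))))} with hF
  have hlarge : ∀ᵐ x ∂volume.restrict D, 2 * l ≤ |u x - c| / N → x ∈ F := by
    have hpt := hJ.ae_enorm_sub_average_le hn (fun x hx => (hsle x hx).trans hsP2) hP hvi
      (hgm.const_mul _)
    filter_upwards [hpt, ae_restrict_mem hDm] with x hx hxD hxl
    refine ⟨hxD, ?_⟩
    rw [hδD] at hx
    set p := ∫⁻ y in D, g y * ENNReal.ofReal (dist x y ^ (-(s x * (n - 1 : ℕ)))) with hp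
    have hMp : ∫⁻ y in D, ENNReal.ofReal M * g y *
        ENNReal.ofReal (dist x y ^ (-(s x * (n - 1 : ℕ)))) = ENNReal.ofReal M * p := by
      simp_rw [mul_assoc]
      exact lintegral_const_mul' _ _ ENNReal.ofReal_ne_top
    rw [hMp, ← mul_assoc, ← ENNReal.ofReal_mul hA0.le] at hx
    have hΦx : Φ (u x) = l := by
      simp only [hΦ]
      rw [smoothTruncation_eq_one, mul_one]
      rw [hscale, le_div_iff₀ hl0]
      exact hxl
    have h1 : ENNReal.ofReal (l / 2) ≤ ENNReal.ofReal (A * M) * p := by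
      refine le_trans ?_ hx
      rw [hΦx, Real.enorm_eq_ofReal (by linarith)]
      exact ENNReal.ofReal_le_ofReal (by linarith)
    by_contra! hcon
    have h2 : ENNReal.ofReal (l / 2) ≤ ENNReal.ofReal (A * M * t) := by
      rw [ENNReal.ofReal_mul (by positivity)]
      exact h1.trans (by gcongr)
    rw [ENNReal.ofReal_le_ofReal_iff (by positivity)] at h2
    have h3 : 4 * (A * M) ≤ Θ := le_max_right _ _
    have h4 : l = t * Θ := by rw [ht, div_mul_cancel₀ _ (by positivity)]
    have h5 : t * (4 * (A * M)) ≤ t * Θ := by gcongr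
    linarith
  calc ∫⁻ x in D, ({x | 2 * l ≤ |u x - c| / N}).indicator
        (fun x => ENNReal.ofReal (l ^ ((n : ℝ) / (s x * (n - 1 : ℕ))))) x
      ≤ ∫⁻ x in D, F.indicator (fun x => ENNReal.ofReal (Θ ^ n) *
          ENNReal.ofReal (t ^ ((n : ℝ) / (s x * (n - 1 : ℕ))))) x := by
        refine lintegral_mono_ae ?_
        filter_upwards [hlarge, ae_restrict_mem hDm] with x hx hxD
        by_cases hxl : 2 * l ≤ |u x - c| / N
        · rw [indicator_of_mem (by exact hxl), indicator_of_mem (hx hxl),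
            ← ENNReal.ofReal_mul (by positivity)]
          refine ENNReal.ofReal_le_ofReal ?_
          have h4 : l = Θ * t := by rw [ht, mul_div_cancel₀ _ (by positivity)]
          rw [h4, Real.mul_rpow (by positivity) (by positivity)]
          gcongr
          rw [← Real.rpow_natCast]
          refine Real.rpow_le_rpow_of_exponent_le hΘ1 (div_le_self (by positivity) ?_)
          refine one_le_mul_of_one_le_of_one_le (hJ.one_le x hxD) ?_
          exact_mod_cast (by omega : 1 ≤ n - 1)
        · rw [indicator_of_notMem (by exact hxl)]
          exact zero_le
    _ ≤ ∫⁻ x in F, ENNReal.ofReal (Θ ^ n) *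
          ENNReal.ofReal (t ^ ((n : ℝ) / (s x * (n - 1 : ℕ)))) := by
        refine (lintegral_indicator_le _ _).trans ?_
        exact lintegral_mono' (Measure.restrict_mono subset_rfl Measure.restrict_le_self) le_rfl
    _ = ENNReal.ofReal (Θ ^ n) * ∫⁻ x in F,
          ENNReal.ofReal (t ^ ((n : ℝ) / (s x * (n - 1 : ℕ)))) :=
        lintegral_const_mul' _ _ ENNReal.ofReal_ne_top
    _ ≤ ENNReal.ofReal (Θ ^ n) * (C * ∫⁻ y in D, g y) := by
        gcongr
        exact hC D s hD hs (fun x hx y hy => hJ.dist_le hx hy) hJ.one_le hsle g hgm hg1 t ht1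
    _ = _ := by rw [ENNReal.coe_mul, ENNReal.ofNNReal_toNNReal, mul_assoc]

end SobolevPoincare

section Modular

/-- Summation of dyadic level estimates. -/
theorem lintegral_rpow_le_of_level_estimate {Ω : Type*} [MeasurableSpace Ω] {μ : Measure Ω}
    {f q : Ω → ℝ} {h : Ω → ℝ≥0∞} (hf0 : ∀ x, 0 ≤ f x) (hf : AEMeasurable f μ)
    (hq : AEMeasurable q μ) (hh : AEMeasurable h μ) {n : ℕ}
    (hqn : ∀ᵐ x ∂μ, 0 ≤ q x ∧ q x ≤ n) {C : ℝ≥0∞} {l₀ : ℝ} (hl₀ : 0 < l₀)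
    (hlevel : ∀ l, l₀ ≤ l → ∫⁻ x, ({x | 2 * l ≤ f x}).indicator
        (fun x => ENNReal.ofReal (l ^ q x)) x ∂μ
      ≤ C * ∫⁻ x, ({x | l < f x ∧ f x < 2 * l}).indicator h x ∂μ) :
    ∫⁻ x, ENNReal.ofReal (f x ^ q x) ∂μ
      ≤ ENNReal.ofReal (max 1 (2 * l₀) ^ n) * μ univ
        + ENNReal.ofReal (4 ^ n) * (C * ∫⁻ x, h x ∂μ) := by
  set l : ℕ → ℝ := fun j => 2 ^ j * l₀ with hl
  have hlpos : ∀ j, 0 < l j := fun j => by positivity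
  have hl0 : ∀ j, l₀ ≤ l j := fun j => le_mul_of_one_le_left hl₀.le (one_le_pow₀ one_le_two)
  set B : ℕ → Ω → ℝ≥0∞ := fun j => ({x | 2 * l j ≤ f x}).indicator
    (fun x => ENNReal.ofReal (l j ^ q x)) with hB
  have hBm : ∀ j, AEMeasurable (B j) μ := fun j =>
    ((aemeasurable_const.pow hq).ennreal_ofReal).indicator₀
      (nullMeasurableSet_le aemeasurable_const hf)
  have hpt : ∀ᵐ x ∂μ, ENNReal.ofReal (f x ^ q x)
      ≤ ENNReal.ofReal (max 1 (2 * l₀) ^ n) + ENNReal.ofReal (4 ^ n) * ∑' j, B j x := by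
    filter_upwards [hqn] with x hx
    rcases le_total (f x) (2 * l₀) with hxl | hxl
    · refine le_add_right (ENNReal.ofReal_le_ofReal ?_)
      calc f x ^ q x ≤ (max 1 (2 * l₀)) ^ q x := by
            have := hf0 x
            have := hx.1
            gcongr
            exact hxl.trans (le_max_right _ _)
        _ ≤ (max 1 (2 * l₀)) ^ (n : ℝ) :=
            Real.rpow_le_rpow_of_exponent_le (le_max_left _ _) hx.2
        _ = _ := Real.rpow_natCast _ _
    · obtain ⟨j, hj1, hj2⟩ := exists_nat_pow_near
        (show 1 ≤ f x / (2 * l₀) by rwa [le_div_iff₀ (by positivity), one_mul]) one_lt_two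
      rw [le_div_iff₀ (by positivity)] at hj1
      rw [div_lt_iff₀ (by positivity), pow_succ] at hj2
      refine le_add_left ?_
      calc ENNReal.ofReal (f x ^ q x) ≤ ENNReal.ofReal (4 ^ n) * B j x := by
            have hmem : x ∈ {x | 2 * l j ≤ f x} := by
              simp only [mem_ofPred_eq, hl]
              linarith
            simp only [hB]
            rw [indicator_of_mem hmem, ← ENNReal.ofReal_mul (by positivity)]
            refine ENNReal.ofReal_le_ofReal ?_
            calc f x ^ q x ≤ (4 * l j) ^ q x := by
                  have := hf0 x
                  have := hx.1
                  gcongr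
                  simp only [hl]
                  linarith
              _ = 4 ^ q x * l j ^ q x := Real.mul_rpow (by norm_num) (hlpos j).le
              _ ≤ 4 ^ n * l j ^ q x := by
                  have := hlpos j
                  gcongr
                  rw [← Real.rpow_natCast]
                  exact Real.rpow_le_rpow_of_exponent_le (by norm_num) hx.2
        _ ≤ _ := by
            gcongr
            exact ENNReal.le_tsum j
  have hsum : ∑' j, ∫⁻ x, B j x ∂μ ≤ C * ∫⁻ x, h x ∂μ := by
    calc ∑' j, ∫⁻ x, B j x ∂μ
        ≤ ∑' j, C * ∫⁻ x, ({x | l j < f x ∧ f x < 2 * l j}).indicator h x ∂μ :=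
          ENNReal.tsum_le_tsum fun j => hlevel (l j) (hl0 j)
      _ = C * ∫⁻ x, ∑' j, ({x | l j < f x ∧ f x < 2 * l j}).indicator h x ∂μ := by
          rw [ENNReal.tsum_mul_left, lintegral_tsum fun j => ?_]
          exact hh.indicator₀ ((nullMeasurableSet_lt aemeasurable_const hf).inter
            (nullMeasurableSet_lt hf aemeasurable_const))
      _ ≤ C * ∫⁻ x, h x ∂μ := by
          gcongr with x
          by_cases hx : ∃ j, l j < f x ∧ f x < 2 * l j
          · obtain ⟨j, hj⟩ := hx
            rw [tsum_eq_single j]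
            · exact indicator_le_self _ _ x
            · intro i hij
              refine indicator_of_notMem (fun hi => ?_) _
              have hi : l i < f x ∧ f x < 2 * l i := hi
              have hstep : ∀ a b : ℕ, a < b → 2 * l a ≤ l b := fun a b hab => by
                simp only [hl]
                have : (2 : ℝ) ^ (a + 1) ≤ 2 ^ b := pow_le_pow_right₀ one_le_two hab
                rw [pow_succ] at this
                nlinarith
              rcases lt_or_gt_of_ne hij with hlt | hlt
              · linarith [hstep i j hlt]
              · linarith [hstep j i hlt]
          · have : ∀ j, ({x | l j < f x ∧ f x < 2 * l j}).indicator h x = 0 := fun j =>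
              indicator_of_notMem (s := {x | l j < f x ∧ f x < 2 * l j}) (fun hj => hx ⟨j, hj⟩) _
            simp [this]
  calc ∫⁻ x, ENNReal.ofReal (f x ^ q x) ∂μ
      ≤ ∫⁻ x, ENNReal.ofReal (max 1 (2 * l₀) ^ n) + ENNReal.ofReal (4 ^ n) * ∑' j, B j x ∂μ :=
        lintegral_mono_ae hpt
    _ = ENNReal.ofReal (max 1 (2 * l₀) ^ n) * μ univ
        + ENNReal.ofReal (4 ^ n) * ∑' j, ∫⁻ x, B j x ∂μ := by
        rw [lintegral_add_left measurable_const, lintegral_const,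
          lintegral_const_mul' _ _ ENNReal.ofReal_ne_top, lintegral_tsum hBm]
    _ ≤ _ := by gcongr

variable {n : ℕ}

theorem luxemburgNorm_le_of_modular_le {p f : EuclideanSpace ℝ (Fin n) → ℝ}
    {U : Set (EuclideanSpace ℝ (Fin n))} (hU : MeasurableSet U) (hp : ∀ x ∈ U, 1 ≤ p x) {N C : ℝ}
    (hN : 0 < N) (hC : 1 ≤ C) (h : modular p (fun x => f x / N) U ≤ ENNReal.ofReal C) :
    luxemburgNorm p f U ≤ ENNReal.ofReal (C * N) := by
  have hC0 : 0 < C := by linarith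
  refine iInf₂_le (C * N) ⟨by positivity, ?_⟩
  calc modular p (fun x => f x / (C * N)) U
      ≤ ∫⁻ x in U, ENNReal.ofReal C⁻¹ * ENNReal.ofReal (|f x / N| ^ p x) := by
        refine setLIntegral_mono' hU fun x hx => ?_
        rw [← ENNReal.ofReal_mul (by positivity)]
        refine ENNReal.ofReal_le_ofReal ?_
        have e : |f x / (C * N)| = C⁻¹ * |f x / N| := by
          rw [mul_comm C, ← div_div, abs_div, abs_of_pos hC0, div_eq_inv_mul]
        rw [e, Real.mul_rpow (by positivity) (by positivity)]
        gcongr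
        exact Real.rpow_le_self_of_le_one (by positivity) (inv_le_one_of_one_le₀ hC) (hp x hx)
    _ = ENNReal.ofReal C⁻¹ * modular p (fun x => f x / N) U :=
        lintegral_const_mul' _ _ ENNReal.ofReal_ne_top
    _ ≤ ENNReal.ofReal C⁻¹ * ENNReal.ofReal C := by gcongr
    _ = 1 := by
        rw [← ENNReal.ofReal_mul (by positivity), inv_mul_cancel₀ hC0.ne', ENNReal.ofReal_one]

theorem le_of_essSupOn_eq {s : EuclideanSpace ℝ (Fin n) → ℝ} {D : Set (EuclideanSpace ℝ (Fin n))}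
    {sPlus : ℝ} (hD : IsOpen D) (hs : ContinuousOn s D) (h : essSupOn s D = (sPlus : EReal)) :
    ∀ x ∈ D, s x ≤ sPlus := by
  intro x hx
  by_contra! hlt
  have hae : ∀ᵐ y ∂volume.restrict D, s y ≤ sPlus := by
    have h1 := ae_le_essSup (f := fun x => (s x : EReal)) (μ := volume.restrict D)
    filter_upwards [h1] with y hy
    have h2 : (s y : EReal) ≤ sPlus := h ▸ hy
    exact_mod_cast h2
  have hop : IsOpen (D ∩ s ⁻¹' Ioi sPlus) := hs.isOpen_inter_preimage hD isOpen_Ioi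
  have hpos : 0 < volume (D ∩ s ⁻¹' Ioi sPlus) := hop.measure_pos _ ⟨x, hx, hlt⟩
  rw [ae_restrict_iff' hD.measurableSet] at hae
  refine hpos.ne' (measure_mono_null (fun y hy => ?_) (ae_iff.1 hae))
  simp only [mem_ofPred_eq, Classical.not_imp, not_le]
  exact ⟨hy.1, hy.2⟩

end Modular

theorem mainTheorem5 (n : ℕ) (hn : 2 ≤ n) (α β sPlus δ L : ℝ) :
    ∃ c : ℝ≥0,
      ∀ (D : Set (EuclideanSpace ℝ (Fin n))) (s : EuclideanSpace ℝ (Fin n) → ℝ)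
        (x₀ : EuclideanSpace ℝ (Fin n)),
        IsJohnDomain D s α β x₀ →
        Metric.infDist x₀ (frontier D) = δ →
        IsVariableExponent s D →
        LogHolderOnWith L s D →
        1 ≤ essInfOn s D →
        essSupOn s D = (sPlus : EReal) →
        sPlus < (n : ℝ) / ((n : ℝ) - 1) →
        ∀ (u : EuclideanSpace ℝ (Fin n) → ℝ)
          (G : EuclideanSpace ℝ (Fin n) → EuclideanSpace ℝ (Fin n)),
          MemL11With u G D →
          IntegrableOn u (Metric.ball x₀ δ) ∧
          luxemburgNorm (fun x => (n : ℝ) / (s x * ((n : ℝ) - 1)))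
              (fun x => u x - ⨍ y in Metric.ball x₀ δ, u y) D
            ≤ (c : ℝ≥0∞) * eLpNorm G 1 (volume.restrict D) := by
  by_cases hpar : 0 < α ∧ α ≤ β ∧ 0 < δ ∧ sPlus < (n : ℝ) / ((n : ℝ) - 1)
  swap
  · refine ⟨0, fun D s x₀ hJ hδ _ _ _ _ hsP => absurd ?_ hpar⟩
    exact ⟨hJ.alpha_pos, hJ.alpha_le_beta,
      hδ ▸ hJ.infDist_frontier_pos (by omega) hJ.center_mem, hsP⟩
  obtain ⟨hα, hαβ, hδ0, hsP⟩ := hpar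
  obtain ⟨C, l₀, hl₀, hlevel⟩ :=
    IsJohnDomain.exists_level_estimate (L := L) hn hα hαβ hδ0 hsP
  have hnR : (2 : ℝ) ≤ n := by exact_mod_cast hn
  have hcast : ((n - 1 : ℕ) : ℝ) = (n : ℝ) - 1 := by
    rw [Nat.cast_sub (by omega), Nat.cast_one]
  set K : ℝ≥0∞ := ENNReal.ofReal (max 1 (2 * l₀) ^ n) *
    volume (Metric.closedBall (0 : EuclideanSpace ℝ (Fin n)) β)
      + ENNReal.ofReal (4 ^ n) * (C * 1) with hK
  have hKt : K ≠ ⊤ := by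
    have := (measure_closedBall_lt_top (μ := volume)
      (x := (0 : EuclideanSpace ℝ (Fin n))) (r := β)).ne
    finiteness
  set c : ℝ := max 1 K.toReal with hc
  have hc1 : 1 ≤ c := le_max_left _ _
  refine ⟨c.toNNReal, fun D s x₀ hJ hδ hvar hlog _ hsup _ u G hu => ?_⟩
  have hD := hJ.isOpen
  have hDm := hD.measurableSet
  have hsle := le_of_essSupOn_eq hD hlog.continuousOn hsup
  have hballD : Metric.ball x₀ δ ⊆ D := by
    rw [← hδ]
    exact hD.ball_infDist_frontier_subset hJ.center_mem
  have hGt : ∫⁻ x in D, ‖G x‖ₑ ≠ ⊤ := hu.2.2.ne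
  refine ⟨(hu.1.integrableOn_ball hD hGt hδ0 hballD).1, ?_⟩
  rw [eLpNorm_one_eq_lintegral_enorm]
  set X := ∫⁻ x in D, ‖G x‖ₑ with hX
  set a := ⨍ y in Metric.ball x₀ δ, u y with ha
  set q : EuclideanSpace ℝ (Fin n) → ℝ := fun x => (n : ℝ) / (s x * ((n : ℝ) - 1)) with hq
  have hqbound : ∀ x ∈ D, 1 ≤ q x ∧ q x ≤ n := by
    intro x hx
    have h1 := hJ.one_le x hx
    have h2 : s x * ((n : ℝ) - 1) ≤ n := by
      rw [lt_div_iff₀ (by linarith)] at hsP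
      have : s x * ((n : ℝ) - 1) ≤ sPlus * ((n : ℝ) - 1) :=
        mul_le_mul_of_nonneg_right (hsle x hx) (by linarith)
      linarith
    have h3 : 1 ≤ s x * ((n : ℝ) - 1) := one_le_mul_of_one_le_of_one_le h1 (by linarith)
    exact ⟨(one_le_div (by linarith)).2 h2, div_le_self (by positivity) h3⟩
  have hnorm : ∀ N : ℝ, 0 < N → X ≤ ENNReal.ofReal N →
      luxemburgNorm q (fun x => u x - a) D ≤ ENNReal.ofReal (c * N) := by
    intro N hN hXN
    have hNe : ENNReal.ofReal N ≠ 0 := (ENNReal.ofReal_pos.2 hN).ne'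
    refine luxemburgNorm_le_of_modular_le hDm (fun x hx => (hqbound x hx).1) hN hc1 ?_
    have hum := hu.1.aemeasurable
    have hsm := hvar.aemeasurable
    have key := lintegral_rpow_le_of_level_estimate (μ := volume.restrict D)
      (f := fun x => |u x - a| / N) (q := q) (h := fun x => ‖G x‖ₑ / ENNReal.ofReal N)
      (fun x => by positivity) (by fun_prop) (by fun_prop)
      (hu.2.aestronglyMeasurable.enorm.div_const _) (n := n)
      (by
        filter_upwards [ae_restrict_mem hDm] with x hx
        exact ⟨by linarith [(hqbound x hx).1], (hqbound x hx).2⟩)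
      hl₀ (C := C) (fun l hl => by
        have := hlevel D s x₀ hJ hδ hlog hsle u G hu.1 N hN hXN l hl
        rwa [hcast] at this)
    have e : modular q (fun x => (u x - a) / N) D
        = ∫⁻ x in D, ENNReal.ofReal ((|u x - a| / N) ^ q x) := by
      simp only [modular, abs_div, abs_of_pos hN]
    rw [e]
    calc _ ≤ _ := key
      _ ≤ K := by
          rw [hK, Measure.restrict_apply_univ]
          refine add_le_add (mul_le_mul_right ?_ _)
            (mul_le_mul_right (mul_le_mul_right ?_ _) _)
          · rw [← Measure.addHaar_closedBall_center volume x₀ β]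
            exact measure_mono fun x hx => hJ.dist_center_le hx
          · simp_rw [div_eq_mul_inv]
            rw [lintegral_mul_const' _ _ (ENNReal.inv_ne_top.2 hNe), ← div_eq_mul_inv]
            exact ENNReal.div_le_of_le_mul (by rwa [one_mul])
      _ = ENNReal.ofReal K.toReal := (ENNReal.ofReal_toReal hKt).symm
      _ ≤ ENNReal.ofReal c := ENNReal.ofReal_le_ofReal (le_max_right _ _)
  refine ENNReal.le_of_forall_pos_le_add fun ε hε _ => ?_
  have hc0 : 0 < c := by linarith
  have hεR : (0 : ℝ) < ε := hε
  refine (hnorm (X.toReal + ε / c) (by positivity) ?_).trans_eq ?_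
  · rw [ENNReal.ofReal_add (by positivity) (by positivity), ENNReal.ofReal_toReal hGt]
    exact le_self_add
  · rw [mul_add, mul_div_cancel₀ _ hc0.ne', ENNReal.ofReal_add (by positivity) (by positivity),
      ENNReal.ofReal_mul hc0.le, ENNReal.ofReal_toReal hGt, ENNReal.ofReal_coe_nnreal,
      ENNReal.ofNNReal_toNNReal]
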